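/- Let $R$ be an integral domain which is not a field and such that $R/(m)$ is finite for every $m\in R^\times:=R\setminus\{0\}$; let $Q(R)$ be its quotient field. Let $\mathfrak A[R]$ be the universal C*-algebra generated by isometries $s_m$ ($m\in R^\times$) and unitaries $u^n$ ($n\in R$) with the relations $s_ks_m=s_{km}$, $u^lu^n=u^{l+n}$, $s_mu^n=u^{mn}s_m$ and $\sum_{n+(m)\in R/(m)}u^ns_ms_m^*u^{-n}=1$ for all $k,m\in R^\times$, $l,n\in R$. Let $\mathfrak A(R)$ be the C*-inductive limit of the system $\{\mathfrak A(R)_m;\varphi_{m,lm}\}$ indexed by $R^\times$ ordered by divisibility, where $\mathfrak A(R)_m=\mathfrak A[R]$ and $\varphi_{m,lm}(x)=s_lxs_l^*$, and let $\omega_m:\mathfrak A[R]=\mathfrak A(R)_m\to\mathfrak A(R)$ be the canonical maps. Let $\hat R=\varprojlim_m R/(m)$ with the topology induced from the product of the finite discrete rings $R/(m)$, $m\in R^\times$, and let $\mathscr R=\varinjlim\{\mathscr R_m;\phi_{m,lm}\}$ with the inductive limit topology, where $\mathscr R_m=\hat R$ and $\phi_{m,lm}$ is multiplication by $l$; identify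 $\hat R$ with the compact open subset $\mathscr R_1$ of the ring $\mathscr R\supseteq Q(R)$, and let $p_{\hat R}\in C_0(\mathscr R)$ be its characteristic function. Let $P_{Q(R)}$ be the discrete group of matrices $\left(\begin{smallmatrix}a&b\\0&1\end{smallmatrix}\right)$ with $a\in Q(R)\setminus\{0\}$, $b\in Q(R)$, acting on $\mathscr R$ by the affine maps $x\mapsto ax+b$ and on $C_0(\mathscr R)$ by $(\alpha_gf)(x)=f(g^{-1}x)$, and let $C_0(\mathscr R)\rtimes P_{Q(R)}$ be the (full) crossed product, with implementing unitaries $V_g$, $V_gfV_g^*=\alpha_g(f)$. Then there are *-isomorphisms $$\Phi:\mathfrak A(R)\longrightarrow C_0(\mathscr R)\rtimes P_{Q(R)},\qquad \beta:\mathfrak A[R]\longrightarrow p_{\hat R}\bigl(C_0(\mathscr R)\rtimes P_{Q(R)}\bigr)p_{\hat R}$$ such that $\beta(u^n)=V_{\left(\begin{smallmatrix}1&n\\0&1\end{smallmatrix}\right)}p_{\hat R}$ for all $n\in R$, $\beta(s_m)=V_{\left(\begin{smallmatrix}m&0\\0&1\end{smallmatrix}\right)}p_{\hat R}$ for all $m\in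 R^\times$, and $$\Phi(\omega_k(x))=V_{\left(\begin{smallmatrix}k&0\\0&1\end{smallmatrix}\right)}^*\,\beta(x)\,V_{\left(\begin{smallmatrix}k&0\\0&1\end{smallmatrix}\right)}\qquad(k\in R^\times,\ x\in\mathfrak A[R]).$$ -/

import Mathlib

open scoped nonZeroDivisors ZeroAtInfty

namespace RingCStar

noncomputable section

/-! ### C⋆-seminorms and the C⋆-algebras they define -/

/-- A C⋆-seminorm on a complex ⋆-algebra. -/
structure CStarSeminorm (A : Type*) [NonUnitalRing A] [StarRing A] [Module ℂ A] where
  toSeminorm : Seminorm ℂ A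
  mul_le : ∀ a b, toSeminorm (a * b) ≤ toSeminorm a * toSeminorm b
  star_mul_self : ∀ a, toSeminorm (star a * a) = toSeminorm a ^ 2

namespace CStarSeminorm

variable {A : Type*} [NonUnitalRing A] [StarRing A] [Module ℂ A]

instance : CoeFun (CStarSeminorm A) (fun _ => A → ℝ) := ⟨fun q => q.toSeminorm⟩

variable (q : CStarSeminorm A)

theorem nonneg (a : A) : 0 ≤ q a := apply_nonneg q.toSeminorm a

theorem le_star (a : A) : q a ≤ q (star a) := by
  have h := q.star_mul_self a
  have h2 := q.mul_le (star a) a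
  have h3 := q.nonneg a
  have h4 := q.nonneg (star a)
  rcases h3.eq_or_lt with h0 | h0
  · rw [← h0]; exact h4
  · nlinarith

theorem star_eq (a : A) : q (star a) = q a :=
  le_antisymm (by simpa using q.le_star (star a)) (q.le_star a)

/-- A copy of `A`, carrying the topology of the seminorm `q`. -/
def Pre (_q : CStarSeminorm A) : Type _ := A

instance : NonUnitalRing q.Pre := inferInstanceAs (NonUnitalRing A)
instance : StarRing q.Pre := inferInstanceAs (StarRing A)
instance : Module ℂ q.Pre := inferInstanceAs (Module ℂ A)
instance [StarModule ℂ A] : StarModule ℂ q.Pre := inferInstanceAs (StarModule ℂ A)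
instance [IsScalarTower ℂ A A] : IsScalarTower ℂ q.Pre q.Pre :=
  inferInstanceAs (IsScalarTower ℂ A A)
instance [SMulCommClass ℂ A A] : SMulCommClass ℂ q.Pre q.Pre :=
  inferInstanceAs (SMulCommClass ℂ A A)

instance : NonUnitalSeminormedRing q.Pre where
  __ := AddGroupSeminorm.toSeminormedAddCommGroup (E := q.Pre) q.toSeminorm.toAddGroupSeminorm
  __ := (inferInstance : NonUnitalRing q.Pre)
  norm_mul_le a b := q.mul_le a b

instance : NormedSpace ℂ q.Pre where
  norm_smul_le c a := (map_smul_eq_mul q.toSeminorm c (a : A)).le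

instance : NormedStarGroup q.Pre where
  norm_star_le a := (q.star_eq (a : A)).le

/-- The Hausdorff completion of `A` with respect to the C⋆-seminorm `q`. -/
def Compl : Type _ := UniformSpace.Completion q.Pre

open UniformSpace Function

instance : NormedAddCommGroup q.Compl := inferInstanceAs (NormedAddCommGroup (Completion q.Pre))
instance : NormedSpace ℂ q.Compl := inferInstanceAs (NormedSpace ℂ (Completion q.Pre))
instance : CompleteSpace q.Compl := inferInstanceAs (CompleteSpace (Completion q.Pre))

/-- The canonical map from `A` to its completion. -/
def coe (a : A) : q.Compl := ((show q.Pre from a : q.Pre) : Completion q.Pre)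

theorem coe_add (a b : A) : q.coe (a + b) = q.coe a + q.coe b :=
  Completion.coe_add (α := q.Pre) a b

theorem coe_zero : q.coe 0 = 0 := rfl

theorem coe_smul (c : ℂ) (a : A) : q.coe (c • a) = c • q.coe a :=
  Completion.coe_smul (X := q.Pre) c a

theorem norm_coe (a : A) : ‖q.coe a‖ = q a := Completion.norm_coe (E := q.Pre) a

theorem isDenseInducing_coe : IsDenseInducing (fun a : q.Pre => (q.coe a : q.Compl)) :=
  Completion.isDenseInducing_coe (α := q.Pre)

theorem continuous_coe : Continuous (fun a : q.Pre => (q.coe a : q.Compl)) :=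
  Completion.continuous_coe q.Pre

theorem denseRange_coe : DenseRange (q.coe : A → q.Compl) :=
  q.isDenseInducing_coe.dense

instance : Mul q.Compl :=
  ⟨curry <| (q.isDenseInducing_coe.prodMap q.isDenseInducing_coe).extend
    (fun p : q.Pre × q.Pre => q.coe ((p.1 * p.2 : q.Pre) : A))⟩

theorem coe_mul (a b : A) : q.coe (a * b) = q.coe a * q.coe b :=
  ((q.isDenseInducing_coe.prodMap q.isDenseInducing_coe).extend_eq
    (q.continuous_coe.comp (continuous_mul (M := q.Pre))) ((a, b) : q.Pre × q.Pre)).symm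

instance : ContinuousMul q.Compl where
  continuous_mul := by
    let m : q.Pre →+ q.Pre →+ q.Compl :=
      (AddMonoidHom.mul : q.Pre →+ q.Pre →+ q.Pre).compr₂
        ⟨⟨fun a => q.coe a, q.coe_zero⟩, q.coe_add⟩
    have : Continuous fun p : q.Pre × q.Pre => m p.1 p.2 :=
      q.continuous_coe.comp continuous_mul
    let t : q.Pre →+ q.Compl := ⟨⟨fun a => q.coe a, q.coe_zero⟩, q.coe_add⟩
    have di : IsDenseInducing (t : q.Pre → q.Compl) := q.isDenseInducing_coe
    exact (di.extend_Z_bilin di this :)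

instance : Star q.Compl := ⟨Completion.map (star : q.Pre → q.Pre)⟩

theorem uniformContinuous_star_pre : UniformContinuous (star : q.Pre → q.Pre) :=
  star_isometry.uniformContinuous

theorem coe_star (a : A) : q.coe (star a) = star (q.coe a) :=
  (Completion.map_coe q.uniformContinuous_star_pre a).symm

theorem continuous_star_compl : Continuous (star : q.Compl → q.Compl) :=
  Completion.continuous_map

@[elab_as_elim]
theorem ind {P : q.Compl → Prop} (x : q.Compl) (hc : IsClosed {x | P x})
    (h : ∀ a : A, P (q.coe a)) : P x :=
  q.denseRange_coe.induction_on x hc h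

@[elab_as_elim]
theorem ind₂ {P : q.Compl → q.Compl → Prop} (x y : q.Compl)
    (hc : IsClosed {x : q.Compl × q.Compl | P x.1 x.2})
    (h : ∀ a b : A, P (q.coe a) (q.coe b)) : P x y :=
  Completion.induction_on₂ (α := q.Pre) (β := q.Pre) x y hc h

@[elab_as_elim]
theorem ind₃ {P : q.Compl → q.Compl → q.Compl → Prop} (x y z : q.Compl)
    (hc : IsClosed {x : q.Compl × q.Compl × q.Compl | P x.1 x.2.1 x.2.2})
    (h : ∀ a b c : A, P (q.coe a) (q.coe b) (q.coe c)) : P x y z :=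
  Completion.induction_on₃ (α := q.Pre) (β := q.Pre) (γ := q.Pre) x y z hc h

instance : NonUnitalNormedRing q.Compl where
  __ := (inferInstance : NormedAddCommGroup q.Compl)
  left_distrib x y z := q.ind₃ x y z (isClosed_eq (by fun_prop) (by fun_prop)) fun a b c => by
    simp only [← coe_add, ← coe_mul, mul_add]
  right_distrib x y z := q.ind₃ x y z (isClosed_eq (by fun_prop) (by fun_prop)) fun a b c => by
    simp only [← coe_add, ← coe_mul, add_mul]
  zero_mul x := q.ind x (isClosed_eq (by fun_prop) (by fun_prop)) fun a => by
    rw [← coe_zero, ← coe_mul, zero_mul]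
  mul_zero x := q.ind x (isClosed_eq (by fun_prop) (by fun_prop)) fun a => by
    rw [← coe_zero, ← coe_mul, mul_zero]
  mul_assoc x y z := q.ind₃ x y z (isClosed_eq (by fun_prop) (by fun_prop)) fun a b c => by
    simp only [← coe_mul, mul_assoc]
  norm_mul_le x y := q.ind₂ x y (isClosed_le (by fun_prop) (by fun_prop)) fun a b => by
    rw [← coe_mul, norm_coe, norm_coe, norm_coe]; exact q.mul_le a b

instance : StarRing q.Compl where
  star_involutive x := q.ind x
    (isClosed_eq (q.continuous_star_compl.comp q.continuous_star_compl) continuous_id) fun a => by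
      simp only [← coe_star, star_star]
  star_mul x y := q.ind₂ x y
    (isClosed_eq (q.continuous_star_compl.comp (by fun_prop))
      ((q.continuous_star_compl.comp continuous_snd).mul
        (q.continuous_star_compl.comp continuous_fst))) fun a b => by
      simp only [← coe_star, ← coe_mul, star_mul]
  star_add x y := q.ind₂ x y
    (isClosed_eq (q.continuous_star_compl.comp (by fun_prop))
      ((q.continuous_star_compl.comp continuous_fst).add
        (q.continuous_star_compl.comp continuous_snd))) fun a b => by
      simp only [← coe_star, ← coe_add, star_add]

instance : CStarRing q.Compl where
  norm_mul_self_le x := q.ind x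
    (isClosed_le (by fun_prop)
      (continuous_norm.comp ((q.continuous_star_compl.comp continuous_id).mul continuous_id)))
    fun a => by
      rw [← coe_star, ← coe_mul, norm_coe, norm_coe, q.star_mul_self, sq]

theorem coe_unit_mul {e : A} (he : ∀ a, e * a = a) (x : q.Compl) : q.coe e * x = x :=
  q.ind x (isClosed_eq (continuous_const.mul continuous_id) continuous_id) fun a => by
    rw [← coe_mul, he]

variable [StarModule ℂ A] [IsScalarTower ℂ A A] [SMulCommClass ℂ A A]

instance : IsScalarTower ℂ q.Compl q.Compl where
  smul_assoc c x y := by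
    change c • x * y = c • (x * y)
    refine q.ind₂ (P := fun x y => c • x * y = c • (x * y)) x y
      (isClosed_eq ((continuous_fst.const_smul c).mul continuous_snd)
        ((continuous_fst.mul continuous_snd).const_smul c)) fun a b => ?_
    rw [← coe_mul, ← coe_smul, ← coe_smul, ← coe_mul, smul_mul_assoc]

instance : SMulCommClass ℂ q.Compl q.Compl where
  smul_comm c x y := by
    change c • (x * y) = x * c • y
    refine q.ind₂ (P := fun x y => c • (x * y) = x * c • y) x y
      (isClosed_eq ((continuous_fst.mul continuous_snd).const_smul c)
        (continuous_fst.mul (continuous_snd.const_smul c))) fun a b => ?_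
    rw [← coe_mul, ← coe_smul, ← coe_smul, ← coe_mul, mul_smul_comm]

instance : StarModule ℂ q.Compl where
  star_smul c x := by
    refine q.ind (P := fun x => star (c • x) = star c • star x) x
      (isClosed_eq (q.continuous_star_compl.comp (continuous_const_smul c))
        (q.continuous_star_compl.const_smul (star c))) fun a => ?_
    rw [← coe_star, ← coe_smul, ← coe_smul, ← coe_star, star_smul]

/-- The completion of a ⋆-algebra with respect to a C⋆-seminorm is a C⋆-algebra. -/
instance : NonUnitalCStarAlgebra q.Compl where

/-- The canonical ⋆-homomorphism from `A` to its completion. -/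
def toCompl : A →⋆ₙₐ[ℂ] q.Compl where
  toFun := q.coe
  map_smul' := q.coe_smul
  map_zero' := q.coe_zero
  map_add' := q.coe_add
  map_mul' := q.coe_mul
  map_star' := q.coe_star

theorem le_norm {B : Type*} [NonUnitalCStarAlgebra B] (q : CStarSeminorm B) (b : B) :
    q b ≤ ‖b‖ := by
  have h := NonUnitalStarAlgHom.norm_apply_le q.toCompl b
  rwa [show q.toCompl b = q.coe b from rfl, norm_coe] at h

/-- The pull-back of a C⋆-seminorm along a ⋆-homomorphism. -/
def comap {B : Type*} [NonUnitalRing B] [StarRing B] [Module ℂ B]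
    (q : CStarSeminorm A) (φ : B →⋆ₙₐ[ℂ] A) : CStarSeminorm B where
  toSeminorm := q.toSeminorm.comp (φ : B →ₗ[ℂ] A)
  mul_le a b := by
    have := q.mul_le (φ a) (φ b)
    simpa using this
  star_mul_self a := by
    have := q.star_mul_self (φ a)
    simpa [map_star] using this

instance : Zero (CStarSeminorm A) := ⟨⟨0, by simp, by simp⟩⟩

end CStarSeminorm

/-! ### Universal C⋆-algebras -/

section Universal

variable (A : Type*) [NonUnitalRing A] [StarRing A] [Module ℂ A]

/-- The C⋆-seminorms on `A` in which all elements of `rels` vanish. -/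
def admissible (rels : Set A) : Set (CStarSeminorm A) := {q | ∀ x ∈ rels, q x = 0}

/-- Every element of `A` is bounded in all C⋆-seminorms that respect the relations. -/
def IsBounded (rels : Set A) : Prop :=
  ∀ a : A, BddAbove (Set.range fun q : admissible A rels => q.1 a)

variable {A} {rels : Set A}

instance : Nonempty (admissible A rels) := ⟨⟨0, fun _ _ => rfl⟩⟩

/-- The largest C⋆-seminorm on `A` that respects the relations. -/
def maxSeminorm (h : IsBounded A rels) : CStarSeminorm A where
  toSeminorm := Seminorm.ofSMulLE (fun a => ⨆ q : admissible A rels, q.1 a)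
    (by simp)
    (fun a b => ciSup_le fun q => (map_add_le_add q.1.toSeminorm a b).trans
      (add_le_add (le_ciSup (h a) q) (le_ciSup (h b) q)))
    (fun c a => ciSup_le fun q => (map_smul_eq_mul q.1.toSeminorm c a).le.trans
      (mul_le_mul_of_nonneg_left (le_ciSup (h a) q) (norm_nonneg c)))
  mul_le a b := ciSup_le fun q => (q.1.mul_le a b).trans
    (mul_le_mul (le_ciSup (h a) q) (le_ciSup (h b) q) (q.1.nonneg b)
      ((q.1.nonneg a).trans (le_ciSup (h a) q)))
  star_mul_self a := by
    change (⨆ q : admissible A rels, q.1 (star a * a)) = (⨆ q : admissible A rels, q.1 a) ^ 2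
    have h0 : 0 ≤ ⨆ q : admissible A rels, q.1 a := Real.iSup_nonneg fun q => q.1.nonneg a
    apply le_antisymm
    · refine ciSup_le fun q => ?_
      rw [q.1.star_mul_self]
      exact pow_le_pow_left₀ (q.1.nonneg a) (le_ciSup (h a) q) 2
    · have h1 : 0 ≤ ⨆ q : admissible A rels, q.1 (star a * a) :=
        Real.iSup_nonneg fun q => q.1.nonneg _
      rw [← Real.le_sqrt h0 h1]
      refine ciSup_le fun q => ?_
      rw [Real.le_sqrt (q.1.nonneg a) h1, ← q.1.star_mul_self]
      exact le_ciSup (h (star a * a)) q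

/-- The universal C⋆-algebra generated by the ⋆-algebra `A` subject to the relations `x = 0` for
`x ∈ rels`: the completion of `A` in the largest C⋆-seminorm that respects the relations. -/
abbrev UniversalCStar (h : IsBounded A rels) : Type _ := (maxSeminorm h).Compl

end Universal

/-! ### Crossed products by discrete groups -/

section CrossedProduct

variable {G A : Type*} [Group G] [NonUnitalCStarAlgebra A]

/-- The ⋆-algebra `C_c(G, A)` of finitely supported functions from the discrete group `G` to `A`
with the convolution product twisted by `α`; `single g a` stands for the formal product
`a · V_g`. -/
def AlgCrossedProduct (_α : G →* (A ≃⋆ₐ[ℂ] A)) : Type _ := G →₀ A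

namespace AlgCrossedProduct

variable (α : G →* (A ≃⋆ₐ[ℂ] A))

instance : AddCommGroup (AlgCrossedProduct α) := inferInstanceAs (AddCommGroup (G →₀ A))
instance : Module ℂ (AlgCrossedProduct α) := inferInstanceAs (Module ℂ (G →₀ A))

/-- The element `a · V_g` of the algebraic crossed product, as an additive map in `a`. -/
def single (g : G) : A →+ AlgCrossedProduct α := Finsupp.singleAddHom g

variable {α}

@[elab_as_elim]
theorem ind {P : AlgCrossedProduct α → Prop} (x : AlgCrossedProduct α)
    (single : ∀ g a, P (single α g a)) (add : ∀ x y, P x → P y → P (x + y)) : P x :=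
  Finsupp.induction_linear (motive := P) x (by
    have h := single 1 0
    rw [map_zero] at h
    exact h) add single

theorem smul_single (c : ℂ) (g : G) (a : A) : c • single α g a = single α g (c • a) :=
  Finsupp.smul_single c g a

variable (α) in
/-- The product, determined by `(a · V_s) (b · V_t) = a α_s(b) · V_{st}`. -/
def mulHom : AlgCrossedProduct α →+ AlgCrossedProduct α →+ AlgCrossedProduct α :=
  Finsupp.liftAddHom fun s => AddMonoidHom.flip <| Finsupp.liftAddHom fun t =>
    AddMonoidHom.flip <| (AddMonoidHom.compr₂ (AddMonoidHom.mul.compl₂ ((α s : A →+ A)))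
      (single α (s * t)))

variable (α) in
/-- The involution, determined by `(a · V_s)⋆ = α_{s⁻¹}(a⋆) · V_{s⁻¹}`. -/
def starHom : AlgCrossedProduct α →+ AlgCrossedProduct α :=
  Finsupp.liftAddHom fun s =>
    (single α s⁻¹).comp (((α s⁻¹ : A →+ A)).comp (starAddEquiv : A ≃+ A).toAddMonoidHom)

instance : Mul (AlgCrossedProduct α) := ⟨fun x y => mulHom α x y⟩
instance : Star (AlgCrossedProduct α) := ⟨fun x => starHom α x⟩

theorem single_mul_single (s t : G) (a b : A) :
    single α s a * single α t b = single α (s * t) (a * α s b) := by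
  have h : mulHom α (single α s a) = AddMonoidHom.flip (Finsupp.liftAddHom fun t =>
      AddMonoidHom.flip <| (AddMonoidHom.compr₂ (AddMonoidHom.mul.compl₂ ((α s : A →+ A)))
        (single α (s * t)))) a := Finsupp.liftAddHom_apply_single _ s a
  have h2 := DFunLike.congr_fun h (single α t b)
  exact h2.trans (DFunLike.congr_fun (Finsupp.liftAddHom_apply_single (fun t =>
      AddMonoidHom.flip <| (AddMonoidHom.compr₂ (AddMonoidHom.mul.compl₂ ((α s : A →+ A)))
        (single α (s * t)))) t b) a)

theorem star_single (s : G) (a : A) : star (single α s a) = single α s⁻¹ (α s⁻¹ (star a)) := by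
  exact Finsupp.liftAddHom_apply_single (fun s =>
    (single α s⁻¹).comp (((α s⁻¹ : A →+ A)).comp (starAddEquiv : A ≃+ A).toAddMonoidHom)) s a

theorem add_mul' (x y z : AlgCrossedProduct α) : (x + y) * z = x * z + y * z :=
  congrArg (· z) (map_add (mulHom α) x y)

theorem mul_add' (x y z : AlgCrossedProduct α) : x * (y + z) = x * y + x * z :=
  map_add (mulHom α x) y z

theorem star_add' (x y : AlgCrossedProduct α) : star (x + y) = star x + star y :=
  map_add (starHom α) x y

instance : NonUnitalRing (AlgCrossedProduct α) where
  __ := (inferInstance : AddCommGroup (AlgCrossedProduct α))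
  left_distrib := mul_add'
  right_distrib := add_mul'
  zero_mul x := congrArg (· x) (map_zero (mulHom α))
  mul_zero x := map_zero (mulHom α x)
  mul_assoc x y z := by
    refine ind x (fun s a => ?_) fun x₁ x₂ h₁ h₂ => by simp only [add_mul', h₁, h₂]
    refine ind y (fun t b => ?_) fun x₁ x₂ h₁ h₂ => by simp only [add_mul', mul_add', h₁, h₂]
    refine ind z (fun r c => ?_) fun x₁ x₂ h₁ h₂ => by simp only [mul_add', h₁, h₂]
    simp [single_mul_single, mul_assoc]

instance : StarRing (AlgCrossedProduct α) where
  star_involutive x := by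
    refine ind x (fun s a => ?_) fun x₁ x₂ h₁ h₂ => by simp only [star_add', h₁, h₂]
    rw [star_single, star_single, ← map_star, star_star, ← StarAlgEquiv.mul_apply, ← map_mul]
    simp
  star_mul x y := by
    refine ind x (fun s a => ?_) fun x₁ x₂ h₁ h₂ => by
      simp only [add_mul', mul_add', star_add', h₁, h₂]
    refine ind y (fun t b => ?_) fun x₁ x₂ h₁ h₂ => by
      simp only [add_mul', mul_add', star_add', h₁, h₂]
    simp only [single_mul_single, star_single, mul_inv_rev, star_mul, map_mul, ← map_star,
      StarAlgEquiv.mul_apply]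
    congr 3
    rw [← StarAlgEquiv.mul_apply (α s⁻¹), ← map_mul]
    simp
  star_add := star_add'

instance : IsScalarTower ℂ (AlgCrossedProduct α) (AlgCrossedProduct α) where
  smul_assoc c x y := by
    change c • x * y = c • (x * y)
    refine ind x (fun s a => ?_) fun x₁ x₂ h₁ h₂ => by simp only [add_mul, smul_add, h₁, h₂]
    refine ind y (fun t b => ?_) fun x₁ x₂ h₁ h₂ => by simp only [mul_add, smul_add, h₁, h₂]
    simp only [smul_single, single_mul_single, smul_mul_assoc]

instance : SMulCommClass ℂ (AlgCrossedProduct α) (AlgCrossedProduct α) where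
  smul_comm c x y := by
    change c • (x * y) = x * c • y
    refine ind x (fun s a => ?_) fun x₁ x₂ h₁ h₂ => by simp only [add_mul, smul_add, h₁, h₂]
    refine ind y (fun t b => ?_) fun x₁ x₂ h₁ h₂ => by simp only [mul_add, smul_add, h₁, h₂]
    simp only [smul_single, single_mul_single, map_smul, mul_smul_comm]

instance : StarModule ℂ (AlgCrossedProduct α) where
  star_smul c x := by
    refine ind x (fun s a => ?_) fun x₁ x₂ h₁ h₂ => by simp only [star_add, smul_add, h₁, h₂]
    simp only [smul_single, star_single, star_smul, map_smul]

variable (α) in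
/-- The inclusion of the coefficient algebra `A`. -/
def inclusion : A →⋆ₙₐ[ℂ] AlgCrossedProduct α where
  toFun := single α 1
  map_smul' c a := (smul_single c 1 a).symm
  map_zero' := map_zero _
  map_add' := map_add _
  map_mul' a b := by simp [single_mul_single]
  map_star' a := by simp [star_single]

variable (α) in
theorem isBounded : IsBounded (AlgCrossedProduct α) ∅ := by
  intro x
  refine ind x (fun s a => ⟨‖a‖, ?_⟩) ?_
  · rintro _ ⟨q, rfl⟩
    have h := q.1.star_mul_self (star (single α s a))
    rw [star_star, star_single, single_mul_single, ← star_single, q.1.star_eq, mul_inv_cancel,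
      ← StarAlgEquiv.mul_apply, ← map_mul, mul_inv_cancel, map_one, StarAlgEquiv.one_apply] at h
    have h1 := (q.1.comap (inclusion α)).le_norm (a * star a)
    have h2 : q.1 (single α s a) ^ 2 ≤ ‖a‖ ^ 2 := by
      rw [← h, sq ‖a‖, ← CStarRing.norm_self_mul_star]; exact h1
    exact (sq_le_sq₀ (q.1.nonneg _) (norm_nonneg _)).1 h2
  · rintro x y ⟨C, hC⟩ ⟨D, hD⟩
    refine ⟨C + D, ?_⟩
    rintro _ ⟨q, rfl⟩
    exact (map_add_le_add q.1.toSeminorm x y).trans (add_le_add (hC ⟨q, rfl⟩) (hD ⟨q, rfl⟩))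

end AlgCrossedProduct

/-- The (full) crossed product `A ⋊ G` of a C⋆-algebra by an action `α` of a discrete group:
the completion of `C_c(G, A)` in its largest C⋆-seminorm. -/
def CrossedProduct (α : G →* (A ≃⋆ₐ[ℂ] A)) : Type _ :=
  UniversalCStar (AlgCrossedProduct.isBounded α)

instance (α : G →* (A ≃⋆ₐ[ℂ] A)) : NonUnitalCStarAlgebra (CrossedProduct α) :=
  inferInstanceAs (NonUnitalCStarAlgebra (UniversalCStar (AlgCrossedProduct.isBounded α)))

/-- The canonical map `A → A ⋊ G`. -/
def CrossedProduct.inclusion (α : G →* (A ≃⋆ₐ[ℂ] A)) : A →⋆ₙₐ[ℂ] CrossedProduct α :=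
  (maxSeminorm (AlgCrossedProduct.isBounded α)).toCompl.comp (AlgCrossedProduct.inclusion α)

/-- The element `V_g a = α_g(a) V_g` of the crossed product, for `g ∈ G` and `a ∈ A`. -/
def CrossedProduct.V (α : G →* (A ≃⋆ₐ[ℂ] A)) (g : G) (a : A) : CrossedProduct α :=
  (maxSeminorm (AlgCrossedProduct.isBounded α)).toCompl (AlgCrossedProduct.single α g (α g a))

end CrossedProduct

/-! ### Inductive limits of C⋆-algebras -/

section InductiveLimit

variable {ι : Type*} [Preorder ι] [IsDirectedOrder ι] [Nonempty ι]
  {F : ι → Type*} [∀ i, NonUnitalCStarAlgebra (F i)]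
  (f : ∀ i j, i ≤ j → F i →⋆ₙₐ[ℂ] F j) [DirectedSystem F (f · · ·)]

/-- The canonical map of `F i` to the algebraic inductive limit. -/
def toDirectLimit (i : ι) : F i →⋆ₙₐ[ℂ] DirectLimit F f where
  toFun x := ⟦⟨i, x⟩⟧
  map_smul' c x := (DirectLimit.smul_def i x c).symm
  map_zero' := (DirectLimit.zero_def i).symm
  map_add' x y := (DirectLimit.add_def i x y).symm
  map_mul' x y := (DirectLimit.mul_def i x y).symm
  map_star' x := (DirectLimit.star_def i x).symm

theorem directLimit_isBounded : IsBounded (DirectLimit F f) ∅ := by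
  intro x
  induction x using DirectLimit.induction with
  | ih i x =>
    refine ⟨‖x‖, ?_⟩
    rintro _ ⟨q, rfl⟩
    exact (q.1.comap (toDirectLimit f i)).le_norm x

/-- The inductive limit of a directed system of C⋆-algebras: the completion of the algebraic
inductive limit in its largest C⋆-seminorm. -/
def InductiveLimit : Type _ := UniversalCStar (directLimit_isBounded f)

instance : NonUnitalCStarAlgebra (InductiveLimit f) :=
  inferInstanceAs (NonUnitalCStarAlgebra (UniversalCStar (directLimit_isBounded f)))

/-- The canonical map of `F i` to the inductive limit. -/
def InductiveLimit.of (i : ι) : F i →⋆ₙₐ[ℂ] InductiveLimit f :=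
  (maxSeminorm (directLimit_isBounded f)).toCompl.comp (toDirectLimit f i)

end InductiveLimit

/-! ### The free ⋆-algebra -/

section Free

/-- The free unital complex ⋆-algebra on a set `X`: the free algebra on the letters `x = inl x` and
`x⋆ = inr x`. -/
def FreeStarAlgebra (X : Type*) : Type _ := FreeAlgebra ℂ (X ⊕ X)

namespace FreeStarAlgebra

variable {X : Type*}

instance : Ring (FreeStarAlgebra X) := inferInstanceAs (Ring (FreeAlgebra ℂ (X ⊕ X)))
instance : Algebra ℂ (FreeStarAlgebra X) := inferInstanceAs (Algebra ℂ (FreeAlgebra ℂ (X ⊕ X)))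

/-- The letters of the free ⋆-algebra. -/
def letter (x : X ⊕ X) : FreeStarAlgebra X := FreeAlgebra.ι ℂ x

/-- The generators of the free ⋆-algebra. -/
def gen (x : X) : FreeStarAlgebra X := letter (Sum.inl x)

@[elab_as_elim]
theorem ind {P : FreeStarAlgebra X → Prop} (a : FreeStarAlgebra X)
    (scalar : ∀ c : ℂ, P (algebraMap ℂ _ c)) (letter : ∀ x, P (letter x))
    (mul : ∀ a b, P a → P b → P (a * b)) (add : ∀ a b, P a → P b → P (a + b)) : P a :=
  FreeAlgebra.induction ℂ (X ⊕ X) (motive := P) scalar letter mul add a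

/-- A copy of the opposite of the free ⋆-algebra on which scalars act by their conjugates. -/
def ConjOp (X : Type*) : Type _ := (FreeStarAlgebra X)ᵐᵒᵖ

instance : Ring (ConjOp X) := inferInstanceAs (Ring (FreeStarAlgebra X)ᵐᵒᵖ)
instance : Algebra ℂ (ConjOp X) :=
  ((algebraMap ℂ (FreeStarAlgebra X)ᵐᵒᵖ).comp (starRingEnd ℂ)).toAlgebra'
    fun c x => Algebra.commutes (A := (FreeStarAlgebra X)ᵐᵒᵖ) (starRingEnd ℂ c) x

/-- The involution, as a homomorphism to the conjugate opposite algebra: it exchanges the letters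
`x` and `x⋆`. -/
def starHom : FreeStarAlgebra X →ₐ[ℂ] ConjOp X :=
  FreeAlgebra.lift ℂ fun x : X ⊕ X => (MulOpposite.op (letter x.swap) : (FreeStarAlgebra X)ᵐᵒᵖ)

instance : Star (FreeStarAlgebra X) :=
  ⟨fun a => MulOpposite.unop (show (FreeStarAlgebra X)ᵐᵒᵖ from starHom a)⟩

theorem star_letter (x : X ⊕ X) : star (letter x) = letter x.swap :=
  congrArg MulOpposite.unop (FreeAlgebra.lift_ι_apply (A := ConjOp X) _ x)

theorem star_algebraMap (c : ℂ) :
    star (algebraMap ℂ (FreeStarAlgebra X) c) = algebraMap ℂ _ (star c) :=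
  congrArg MulOpposite.unop (starHom.commutes c)

theorem star_add' (a b : FreeStarAlgebra X) : star (a + b) = star a + star b :=
  congrArg MulOpposite.unop (map_add starHom a b)

theorem star_mul' (a b : FreeStarAlgebra X) : star (a * b) = star b * star a :=
  congrArg MulOpposite.unop (map_mul starHom a b)

instance : StarRing (FreeStarAlgebra X) where
  star_involutive a := ind a (fun c => by simp only [star_algebraMap, star_star])
    (fun x => by simp only [star_letter, Sum.swap_swap])
    (fun a b ha hb => by simp only [star_mul', ha, hb])
    (fun a b ha hb => by simp only [star_add', ha, hb])
  star_mul := star_mul'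
  star_add := star_add'

instance : StarModule ℂ (FreeStarAlgebra X) where
  star_smul c a := by
    rw [Algebra.smul_def, star_mul, star_algebraMap, Algebra.smul_def, Algebra.commutes]

/-- It suffices to bound the generators. -/
theorem isBounded_of_gen {rels : Set (FreeStarAlgebra X)}
    (h : ∀ x, BddAbove (Set.range fun q : admissible (FreeStarAlgebra X) rels => q.1 (gen x))) :
    IsBounded (FreeStarAlgebra X) rels := by
  intro a
  induction a using ind with
  | scalar c =>
    refine ⟨‖c‖, ?_⟩
    rintro _ ⟨q, rfl⟩
    have h1 : q.1 (1 : FreeStarAlgebra X) ≤ 1 := by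
      have := q.1.star_mul_self 1
      rw [star_one, mul_one] at this
      nlinarith [q.1.nonneg (1 : FreeStarAlgebra X)]
    have h2 := map_smul_eq_mul q.1.toSeminorm c (1 : FreeStarAlgebra X)
    rw [← Algebra.algebraMap_eq_smul_one] at h2
    change q.1.toSeminorm _ ≤ _
    rw [h2]
    exact mul_le_of_le_one_right (norm_nonneg c) h1
  | letter x =>
    rcases x with x | x
    · exact h x
    · obtain ⟨C, hC⟩ := h x
      refine ⟨C, ?_⟩
      rintro _ ⟨q, rfl⟩
      have h1 : (letter (Sum.inr x) : FreeStarAlgebra X) = star (gen x) :=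
        (star_letter (Sum.inl x)).symm
      change q.1 _ ≤ C
      rw [h1, q.1.star_eq]
      exact hC ⟨q, rfl⟩
  | mul a b ha hb =>
    obtain ⟨C, hC⟩ := ha
    obtain ⟨D, hD⟩ := hb
    refine ⟨C * D, ?_⟩
    rintro _ ⟨q, rfl⟩
    have h1 := hC ⟨q, rfl⟩
    exact (q.1.mul_le a b).trans (mul_le_mul h1 (hD ⟨q, rfl⟩) (q.1.nonneg b)
      ((q.1.nonneg a).trans h1))
  | add a b ha hb =>
    obtain ⟨C, hC⟩ := ha
    obtain ⟨D, hD⟩ := hb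
    refine ⟨C + D, ?_⟩
    rintro _ ⟨q, rfl⟩
    exact (map_add_le_add q.1.toSeminorm a b).trans (add_le_add (hC ⟨q, rfl⟩) (hD ⟨q, rfl⟩))

end FreeStarAlgebra

end Free

/-! ### The C⋆-algebra of an integral domain and its stabilization -/

section RingAlgebra

variable (R : Type*) [CommRing R]

/-- The symbols `s_m` (`0 ≠ m ∈ R`) and `u^n` (`n ∈ R`). -/
inductive Gen : Type _
  | s (m : R⁰) : Gen
  | u (n : R) : Gen

variable {R}

/-- The symbol `s_m` in the free ⋆-algebra. -/
def fs (m : R⁰) : FreeStarAlgebra (Gen R) := .gen (.s m)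

/-- The symbol `u^n` in the free ⋆-algebra. -/
def fu (n : R) : FreeStarAlgebra (Gen R) := .gen (.u n)

variable (R)

/-- The defining relations of `𝔄[R]`, written as elements which have to vanish. In the last one
`q.out` is a representative of the coset `q`. -/
inductive Rel : FreeStarAlgebra (Gen R) → Prop
  | isometry (m : R⁰) : Rel (star (fs m) * fs m - 1)
  | unitary_left (n : R) : Rel (star (fu n) * fu n - 1)
  | unitary_right (n : R) : Rel (fu n * star (fu n) - 1)
  | s_mul (k m : R⁰) : Rel (fs k * fs m - fs (k * m))
  | u_mul (l n : R) : Rel (fu l * fu n - fu (l + n))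
  | s_mul_u (m : R⁰) (n : R) : Rel (fs m * fu n - fu (m * n) * fs m)
  | sum_eq_one (m : R⁰) :
      Rel ((∑ᶠ q : R ⧸ Ideal.span {(m : R)},
        fu q.out * (fs m * star (fs m)) * fu (-q.out)) - 1)

theorem rel_isBounded : IsBounded (FreeStarAlgebra (Gen R)) {x | Rel R x} := by
  have key : ∀ (q : admissible (FreeStarAlgebra (Gen R)) {x | Rel R x})
      (x : FreeStarAlgebra (Gen R)), q.1 (star x * x - 1) = 0 → q.1 x ≤ 1 := by
    intro q x hx
    have h1 : q.1 (1 : FreeStarAlgebra (Gen R)) ≤ 1 := by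
      have := q.1.star_mul_self 1
      rw [star_one, mul_one] at this
      nlinarith [q.1.nonneg (1 : FreeStarAlgebra (Gen R))]
    have h2 := map_add_le_add q.1.toSeminorm (star x * x - 1) 1
    rw [sub_add_cancel, hx, q.1.star_mul_self] at h2
    nlinarith [q.1.nonneg x]
  refine FreeStarAlgebra.isBounded_of_gen fun x => ⟨1, ?_⟩
  rintro _ ⟨q, rfl⟩
  cases x with
  | s m => exact key q (fs m) (q.2 _ (Rel.isometry m))
  | u n => exact key q (fu n) (q.2 _ (Rel.unitary_left n))

/-- The universal C⋆-algebra `𝔄[R]` generated by isometries `s_m` and unitaries `u^n` subject to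
the relations above. -/
def RingAlg : Type _ := UniversalCStar (rel_isBounded R)

instance : NonUnitalCStarAlgebra (RingAlg R) :=
  inferInstanceAs (NonUnitalCStarAlgebra (UniversalCStar (rel_isBounded R)))

variable {R}

/-- The canonical map of the free ⋆-algebra to `𝔄[R]`. -/
def RingAlg.of : FreeStarAlgebra (Gen R) →⋆ₙₐ[ℂ] RingAlg R :=
  (maxSeminorm (rel_isBounded R)).toCompl

/-- The isometry `s_m ∈ 𝔄[R]`. -/
def RingAlg.s (m : R⁰) : RingAlg R := RingAlg.of (fs m)

/-- The unitary `u^n ∈ 𝔄[R]`. -/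
def RingAlg.u (n : R) : RingAlg R := RingAlg.of (fu n)

/-- The unit of `𝔄[R]`. -/
instance : One (RingAlg R) := ⟨RingAlg.of 1⟩

namespace RingAlg

theorem of_rel {x : FreeStarAlgebra (Gen R)} (h : Rel R x) : (of x : RingAlg R) = 0 := by
  rw [← norm_eq_zero]
  refine ((maxSeminorm (rel_isBounded R)).norm_coe x).trans ?_
  change (⨆ q : admissible (FreeStarAlgebra (Gen R)) {x | Rel R x}, q.1 x) = 0
  rw [show (fun q : admissible (FreeStarAlgebra (Gen R)) {x | Rel R x} => q.1 x) = fun _ => 0 from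
    funext fun q => q.2 x h]
  simp

theorem of_eq {x y : FreeStarAlgebra (Gen R)} (h : Rel R (x - y)) :
    (of x : RingAlg R) = of y := by
  have := of_rel h
  rwa [map_sub, sub_eq_zero] at this

theorem one_mul' (x : RingAlg R) : 1 * x = x :=
  (maxSeminorm (rel_isBounded R)).coe_unit_mul (e := 1) (fun a => one_mul a) x

theorem star_s_mul_s (m : R⁰) : star (s m) * s m = (1 : RingAlg R) := by
  rw [s, ← map_star, ← map_mul]
  exact of_eq (Rel.isometry m)

theorem s_mul_s (k m : R⁰) : s k * s m = (s (k * m) : RingAlg R) := by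
  rw [s, s, ← map_mul]
  exact of_eq (Rel.s_mul k m)

/-- The endomorphism `x ↦ s_l x s_l⋆` of `𝔄[R]`. -/
def conj (l : R⁰) : RingAlg R →⋆ₙₐ[ℂ] RingAlg R where
  toFun x := s l * x * star (s l)
  map_smul' c x := by simp [mul_smul_comm, smul_mul_assoc]
  map_zero' := by simp
  map_add' x y := by simp [mul_add, add_mul]
  map_mul' x y := by
    have h : star (s l) * (s l * (y * star (s l))) = y * star (s l) := by
      rw [← mul_assoc, star_s_mul_s, one_mul']
    simp only [mul_assoc, h]
  map_star' x := by simp [mul_assoc]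

theorem conj_conj (k l : R⁰) (x : RingAlg R) : conj k (conj l x) = conj (k * l) x := by
  change s k * (s l * x * star (s l)) * star (s k) = s (k * l) * x * star (s (k * l))
  rw [← s_mul_s, star_mul]
  simp only [mul_assoc]

theorem s_one : (s 1 : RingAlg R) = 1 := by
  have h := s_mul_s (1 : R⁰) 1
  rw [one_mul] at h
  have h2 := congrArg (star (s (1 : R⁰)) * ·) h
  simp only [← mul_assoc, star_s_mul_s] at h2
  rwa [one_mul'] at h2

end RingAlg

variable (R) in
/-- The nonzero elements of `R` as an index set, (pre)ordered by divisibility. -/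
structure DivIndex where
  val : R⁰

instance : Nonempty (DivIndex R) := ⟨⟨1⟩⟩

instance : Preorder (DivIndex R) where
  le m n := ∃ l : R⁰, n.val = l * m.val
  le_refl m := ⟨1, (one_mul m.val).symm⟩
  le_trans m n k := by
    rintro ⟨l, hl⟩ ⟨l', hl'⟩
    exact ⟨l' * l, by rw [hl', hl, mul_assoc]⟩

instance : IsDirectedOrder (DivIndex R) where
  directed m n := ⟨⟨m.val * n.val⟩, ⟨n.val, mul_comm _ _⟩, ⟨m.val, rfl⟩⟩

/-- The connecting map `φ_{m,lm} : 𝔄[R] → 𝔄[R]`, `x ↦ s_l x s_l⋆`, where `l` is the quotient of the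
two indices. -/
def connect (m n : DivIndex R) (h : m ≤ n) : RingAlg R →⋆ₙₐ[ℂ] RingAlg R :=
  RingAlg.conj h.choose

theorem connect_eq (m n : DivIndex R) (h : m ≤ n) (l : R⁰) (hl : n.val = l * m.val) :
    connect m n h = RingAlg.conj l := by
  have h1 := h.choose_spec
  rw [connect]
  congr 1
  have h2 : ((h.choose : R⁰) : R) * m.val = l * m.val := by
    exact_mod_cast h1.symm.trans hl
  exact Subtype.ext ((mul_cancel_right_mem_nonZeroDivisors m.val.2).1 h2)

instance : DirectedSystem (fun _ : DivIndex R => RingAlg R) (connect · · ·) where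
  map_self m x := by
    rw [connect_eq m m le_rfl 1 (one_mul m.val).symm]
    change RingAlg.s 1 * x * star (RingAlg.s 1) = x
    rw [RingAlg.s_one]
    have h := congrArg star (RingAlg.one_mul' (star x))
    rw [star_mul, star_star] at h
    rw [RingAlg.one_mul', h]
  map_map k n m hmn hnk x := by
    obtain ⟨l, hl⟩ := id hmn
    obtain ⟨l', hl'⟩ := id hnk
    rw [connect_eq _ _ hmn l hl, connect_eq _ _ hnk l' hl',
      connect_eq _ _ (hmn.trans hnk) (l' * l) (by rw [hl', hl, mul_assoc]),
      RingAlg.conj_conj]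

variable (R) in
/-- The stabilization `𝔄(R)`: the inductive limit of copies `𝔄(R)_m` of `𝔄[R]`, for `m` in the
nonzero elements of `R` ordered by divisibility, along the maps `φ_{m,lm} : x ↦ s_l x s_l⋆`. -/
def StableAlg : Type _ :=
  InductiveLimit (F := fun _ : DivIndex R => RingAlg R) connect

instance : NonUnitalCStarAlgebra (StableAlg R) :=
  inferInstanceAs (NonUnitalCStarAlgebra
    (InductiveLimit (F := fun _ : DivIndex R => RingAlg R) connect))

/-- The canonical map `𝔄[R] = 𝔄(R)_m → 𝔄(R)`. -/
def StableAlg.of (m : R⁰) : RingAlg R →⋆ₙₐ[ℂ] StableAlg R :=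
  InductiveLimit.of (F := fun _ : DivIndex R => RingAlg R) connect ⟨m⟩

end RingAlgebra

/-! ### The profinite completion and the finite adele space -/

section Adele

variable (R : Type*) [CommRing R]

theorem span_mul_le (l m : R⁰) :
    Ideal.span {((l * m : R⁰) : R)} ≤ Ideal.span {(m : R)} := by
  rw [Ideal.span_singleton_le_span_singleton]
  exact ⟨l, by rw [Submonoid.coe_mul, mul_comm]⟩

/-- The compatible families in `∏_{m ≠ 0} R/(m)`. -/
def hatSubalgebra : Subalgebra R (∀ m : R⁰, R ⧸ Ideal.span {(m : R)}) where
  carrier := {r | ∀ l m : R⁰, Ideal.Quotient.factor (span_mul_le R l m) (r (l * m)) = r m}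
  mul_mem' {a b} ha hb l m := by rw [Pi.mul_apply, Pi.mul_apply, map_mul, ha, hb]
  add_mem' {a b} ha hb l m := by rw [Pi.add_apply, Pi.add_apply, map_add, ha, hb]
  algebraMap_mem' _ _ _ := rfl

/-- The profinite completion `R̂ = lim R/(m)`. -/
def Hat : Type _ := hatSubalgebra R

instance : CommRing (Hat R) := inferInstanceAs (CommRing (hatSubalgebra R))
instance : Algebra R (Hat R) := inferInstanceAs (Algebra R (hatSubalgebra R))

variable {R}

/-- The component of an element of `R̂` in `R/(m)`. -/
def Hat.comp (x : Hat R) (m : R⁰) : R ⧸ Ideal.span {(m : R)} :=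
  (show hatSubalgebra R from x).1 m

/-- `R̂` carries the topology induced by the product of the discrete rings `R/(m)`. -/
instance : TopologicalSpace (Hat R) :=
  TopologicalSpace.induced Hat.comp (@Pi.topologicalSpace _ _ fun _ => ⊥)

variable (R) in
/-- The finite adele space `𝓡 = lim (R̂ ; multiplication by l : 𝓡_m → 𝓡_{lm})`, that is, the
quotient of `∐_{m ≠ 0} R̂` in which `x ∈ 𝓡_l` and `y ∈ 𝓡_m` are identified when `umx = uly` for
some `u`. It is a module over the quotient field of `R`. -/
def Adele : Type _ := LocalizedModule R⁰ (Hat R)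

instance : CommRing (Adele R) := inferInstanceAs (CommRing (LocalizedModule R⁰ (Hat R)))
instance : Module (FractionRing R) (Adele R) :=
  inferInstanceAs (Module (Localization R⁰) (LocalizedModule R⁰ (Hat R)))

/-- The map `ι_m : R̂ = 𝓡_m → 𝓡`. -/
def Adele.ι (m : R⁰) (x : Hat R) : Adele R := LocalizedModule.mk x m

/-- The inductive limit topology: a set is open iff its preimages under all `ι_m` are. -/
instance : TopologicalSpace (Adele R) :=
  ⨆ m : R⁰, TopologicalSpace.coinduced (Adele.ι m) inferInstance

namespace Hat

theorem ext {x y : Hat R} (h : ∀ m, x.comp m = y.comp m) : x = y :=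
  Subtype.ext (funext h)

theorem comp_compat (x : Hat R) (l m : R⁰) :
    Ideal.Quotient.factor (span_mul_le R l m) (x.comp (l * m)) = x.comp m :=
  (show hatSubalgebra R from x).2 l m

theorem comp_smul (r : R) (x : Hat R) (m : R⁰) :
    (r • x).comp m = Ideal.Quotient.mk _ r * x.comp m :=
  Algebra.smul_def r (x.comp m)

theorem comp_add (x y : Hat R) (m : R⁰) : (x + y).comp m = x.comp m + y.comp m := rfl

theorem continuous_rng {X : Type*} [TopologicalSpace X] {f : X → Hat R}
    (h : ∀ m, @Continuous _ _ _ ⊥ fun x => (f x).comp m) : Continuous f := by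
  let _ : ∀ m : R⁰, TopologicalSpace (R ⧸ Ideal.span {(m : R)}) := fun _ => ⊥
  exact continuous_induced_rng.2 (continuous_pi h)

theorem continuous_comp (m : R⁰) : @Continuous _ _ _ ⊥ fun x : Hat R => x.comp m := by
  let _ : ∀ m : R⁰, TopologicalSpace (R ⧸ Ideal.span {(m : R)}) := fun _ => ⊥
  exact (continuous_apply m).comp continuous_induced_dom

theorem continuous_affine (r : R) (y : Hat R) : Continuous fun x : Hat R => r • x + y := by
  refine continuous_rng fun m => ?_
  let _ : TopologicalSpace (R ⧸ Ideal.span {(m : R)}) := ⊥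
  have : DiscreteTopology (R ⧸ Ideal.span {(m : R)}) := ⟨rfl⟩
  have h : (fun x : Hat R => (r • x + y).comp m) =
      (fun z => Ideal.Quotient.mk _ r * z + y.comp m) ∘ fun x : Hat R => x.comp m :=
    funext fun x => by simp only [comp_add, comp_smul, Function.comp]
  rw [h]
  exact continuous_of_discreteTopology.comp (continuous_comp m)

theorem isClopen_comp_eq_zero (m : R⁰) : IsClopen {x : Hat R | x.comp m = 0} := by
  let _ : TopologicalSpace (R ⧸ Ideal.span {(m : R)}) := ⊥
  have : DiscreteTopology (R ⧸ Ideal.span {(m : R)}) := ⟨rfl⟩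
  exact (isClopen_discrete {(0 : R ⧸ Ideal.span {(m : R)})}).preimage (continuous_comp m)

/-- Multiplication by a nonzero element of `R` is injective on `R̂`. -/
theorem smul_cancel (l : R⁰) {x y : Hat R} (h : l • x = l • y) : x = y := by
  refine ext fun m => ?_
  have h1 := congrArg (fun z : Hat R => z.comp (l * m)) h
  change ((l : R) • x).comp (l * m) = ((l : R) • y).comp (l * m) at h1
  rw [comp_smul, comp_smul] at h1
  rw [← comp_compat x l m, ← comp_compat y l m]
  obtain ⟨a, ha⟩ := Ideal.Quotient.mk_surjective (x.comp (l * m))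
  obtain ⟨b, hb⟩ := Ideal.Quotient.mk_surjective (y.comp (l * m))
  rw [← ha, ← hb] at h1 ⊢
  rw [← map_mul, ← map_mul, Ideal.Quotient.eq, Ideal.mem_span_singleton] at h1
  rw [Ideal.Quotient.factor_mk, Ideal.Quotient.factor_mk, Ideal.Quotient.eq,
    Ideal.mem_span_singleton]
  obtain ⟨c, hc⟩ := h1
  refine ⟨c, (mul_cancel_left_mem_nonZeroDivisors l.2).1 ?_⟩
  rw [mul_sub, hc, Submonoid.coe_mul, mul_assoc]

/-- The kernel of the projection `R̂ → R/(l)` is `l R̂`. -/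
theorem comp_eq_zero_iff (l : R⁰) (x : Hat R) : x.comp l = 0 ↔ ∃ y : Hat R, x = l • y := by
  constructor
  · intro h
    have key : ∀ m : R⁰, ∃ b : R, x.comp (m * l) = Ideal.Quotient.mk _ ((l : R) * b) := by
      intro m
      obtain ⟨a, ha⟩ := Ideal.Quotient.mk_surjective (x.comp (m * l))
      have h1 := comp_compat x m l
      rw [h, ← ha, Ideal.Quotient.factor_mk, Ideal.Quotient.eq_zero_iff_mem,
        Ideal.mem_span_singleton] at h1
      obtain ⟨b, hb⟩ := h1
      exact ⟨b, by rw [← ha, hb]⟩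
    choose b hb using key
    have hmem : (fun m : R⁰ => Ideal.Quotient.mk (Ideal.span {(m : R)}) (b m)) ∈
        hatSubalgebra R := by
      intro k m
      have h1 := comp_compat x k (m * l)
      have h2 : ∀ n : R⁰, n = k * (m * l) → ∀ c : R, x.comp n = Ideal.Quotient.mk _ c →
          x.comp (k * (m * l)) = Ideal.Quotient.mk _ c := by
        rintro n rfl c hc
        exact hc
      rw [h2 _ (mul_assoc k m l) _ (hb (k * m)), hb m, Ideal.Quotient.factor_mk,
        Ideal.Quotient.eq, Ideal.mem_span_singleton] at h1
      rw [Ideal.Quotient.factor_mk, Ideal.Quotient.eq, Ideal.mem_span_singleton]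
      obtain ⟨c, hc⟩ := h1
      refine ⟨c, (mul_cancel_left_mem_nonZeroDivisors l.2).1 ?_⟩
      rw [mul_sub, hc, Submonoid.coe_mul]
      ring
    refine ⟨⟨_, hmem⟩, ext fun m => ?_⟩
    change _ = Hat.comp ((l : R) • (show Hat R from ⟨_, hmem⟩)) m
    have h1 := comp_compat x l m
    have h2 : ∀ n : R⁰, n = l * m → ∀ c : R, x.comp n = Ideal.Quotient.mk _ c →
        x.comp (l * m) = Ideal.Quotient.mk _ c := by
      rintro n rfl c hc
      exact hc
    rw [h2 _ (mul_comm m l) _ (hb m), Ideal.Quotient.factor_mk] at h1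
    rw [comp_smul, ← h1, map_mul]
    rfl
  · rintro ⟨y, rfl⟩
    change ((l : R) • y).comp l = 0
    rw [comp_smul, Ideal.Quotient.eq_zero_iff_mem.2 (Ideal.mem_span_singleton_self (l : R)),
      zero_mul]

instance [∀ m : R⁰, Finite (R ⧸ Ideal.span {(m : R)})] : CompactSpace (Hat R) := by
  let _ : ∀ m : R⁰, TopologicalSpace (R ⧸ Ideal.span {(m : R)}) := fun _ => ⊥
  have : ∀ m : R⁰, DiscreteTopology (R ⧸ Ideal.span {(m : R)}) := fun _ => ⟨rfl⟩
  have hi : Topology.IsInducing (Hat.comp : Hat R → _) := ⟨rfl⟩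
  have hr : Set.range (Hat.comp : Hat R → _) = ⋂ (l : R⁰) (m : R⁰),
      {r | Ideal.Quotient.factor (span_mul_le R l m) (r (l * m)) = r m} := by
    ext r
    simp only [Set.mem_iInter, Set.mem_range]
    exact ⟨fun ⟨x, hx⟩ l m => hx ▸ comp_compat x l m, fun h => ⟨⟨r, h⟩, rfl⟩⟩
  have hc : IsClosed (Set.range (Hat.comp : Hat R → _)) := by
    rw [hr]
    refine isClosed_iInter fun l => isClosed_iInter fun m => isClosed_eq ?_ (continuous_apply m)
    exact continuous_of_discreteTopology.comp (continuous_apply (l * m))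
  exact (Topology.IsClosedEmbedding.mk ⟨hi, fun x y h => ext fun m => congrFun h m⟩
    hc).compactSpace

end Hat

namespace Adele

theorem continuous_ι (m : R⁰) : Continuous (ι m : Hat R → Adele R) :=
  continuous_iff_coinduced_le.2 (le_iSup (fun m : R⁰ =>
    TopologicalSpace.coinduced (Adele.ι m : Hat R → Adele R) inferInstance) m)

theorem continuous_dom {Y : Type*} [TopologicalSpace Y] {f : Adele R → Y}
    (h : ∀ m, Continuous fun x => f (ι m x)) : Continuous f :=
  continuous_iSup_dom.2 fun m => continuous_coinduced_dom.2 (h m)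

variable (R) in
/-- The subset `R̂ = ι_1(R̂)` of `𝓡`. -/
def hat : Set (Adele R) := Set.range (ι 1)

theorem ι_preimage_hat (m : R⁰) : ι m ⁻¹' hat R = {x : Hat R | x.comp m = 0} := by
  ext x
  rw [Set.mem_ofPred_eq, Hat.comp_eq_zero_iff]
  constructor
  · rintro ⟨y, hy⟩
    obtain ⟨u, hu⟩ := LocalizedModule.mk_eq.1 hy
    refine ⟨y, ?_⟩
    have h := Hat.smul_cancel u hu
    rw [one_smul] at h
    exact h.symm
  · rintro ⟨y, rfl⟩
    exact ⟨y, LocalizedModule.mk_eq.2 ⟨1, by simp⟩⟩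

theorem isClopen_hat : IsClopen (hat R) := by
  constructor
  · rw [← isOpen_compl_iff, isOpen_iSup_iff]
    intro m
    rw [isOpen_coinduced, Set.preimage_compl, ι_preimage_hat]
    exact (Hat.isClopen_comp_eq_zero m).compl.isOpen
  · rw [isOpen_iSup_iff]
    intro m
    rw [isOpen_coinduced, ι_preimage_hat]
    exact (Hat.isClopen_comp_eq_zero m).isOpen

variable (R) in
/-- The characteristic function `p_{R̂} ∈ C₀(𝓡)` of the compact open subset `R̂`. -/
def pHat [∀ m : R⁰, Finite (R ⧸ Ideal.span {(m : R)})] : C₀(Adele R, ℂ) where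
  toFun := (hat R).indicator 1
  continuous_toFun := (IsClopen.continuous_indicator isClopen_hat continuous_const)
  zero_at_infty' := by
    have hK : IsCompact (hat R) := isCompact_range (continuous_ι 1)
    refine tendsto_const_nhds.congr' ?_
    filter_upwards [hK.compl_mem_cocompact] with x hx
    exact (Set.indicator_of_notMem hx _).symm

end Adele

end Adele

/-! ### The `ax + b`-group and its affine action -/

section AffineGroup

/-- The `ax + b`-group `P_K` of a field: the matrices with rows `(a, b)` and `(0, 1)`, `a ≠ 0`. -/
@[ext]
structure AffineGroup (K : Type*) [Field K] where
  a : Kˣ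
  b : K

namespace AffineGroup

variable {K : Type*} [Field K]

instance : Mul (AffineGroup K) := ⟨fun g h => ⟨g.a * h.a, g.a * h.b + g.b⟩⟩
instance : One (AffineGroup K) := ⟨⟨1, 0⟩⟩
instance : Inv (AffineGroup K) := ⟨fun g => ⟨g.a⁻¹, -(↑(g.a⁻¹) * g.b)⟩⟩

theorem mul_def (g h : AffineGroup K) : g * h = ⟨g.a * h.a, g.a * h.b + g.b⟩ := rfl
theorem one_def : (1 : AffineGroup K) = ⟨1, 0⟩ := rfl
theorem inv_def (g : AffineGroup K) : g⁻¹ = ⟨g.a⁻¹, -(↑(g.a⁻¹) * g.b)⟩ := rfl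

instance : Group (AffineGroup K) :=
  Group.ofLeftAxioms
    (fun g h k => by
      simp only [mul_def, mk.injEq, mul_assoc, Units.val_mul, true_and]
      ring)
    (fun g => by simp [mul_def, one_def])
    (fun g => by simp [mul_def, one_def, inv_def])

end AffineGroup

variable {R : Type*} [CommRing R] [IsDomain R]

/-- The action of `P_{Q(R)}` on `𝓡` by affine transformations `x ↦ a x + b`. -/
instance : MulAction (AffineGroup (FractionRing R)) (Adele R) where
  smul g x := (g.a : FractionRing R) • x + g.b • (1 : Adele R)
  one_smul x := by
    change (1 : FractionRing R) • x + (0 : FractionRing R) • (1 : Adele R) = x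
    simp
  mul_smul g h x := by
    change ((g.a * h.a : (FractionRing R)ˣ) : FractionRing R) • x +
        ((g.a : FractionRing R) * h.b + g.b) • (1 : Adele R) =
      (g.a : FractionRing R) • ((h.a : FractionRing R) • x + h.b • (1 : Adele R)) +
        g.b • (1 : Adele R)
    rw [Units.val_mul, mul_smul, add_smul, mul_smul, smul_add, add_assoc]

theorem Adele.smul_def (g : AffineGroup (FractionRing R)) (x : Adele R) :
    g • x = (g.a : FractionRing R) • x + g.b • (1 : Adele R) := rfl

/-- The affine transformations of `𝓡` are homeomorphisms. -/
instance : ContinuousConstSMul (AffineGroup (FractionRing R)) (Adele R) where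
  continuous_const_smul g := by
    refine Adele.continuous_dom fun m => ?_
    have hmk : ∀ y : FractionRing R, ∃ (c : R) (d : R⁰), y = Localization.mk c d := fun y =>
      Localization.induction_on y fun p => ⟨p.1, p.2, rfl⟩
    obtain ⟨c, d, hc⟩ := hmk (g.a : FractionRing R)
    obtain ⟨e, d', he⟩ := hmk g.b
    have h : (fun x => g • Adele.ι m x) = fun x : Hat R =>
        Adele.ι (d * m * (d' * 1)) (((d' * 1 : R⁰) * c : R) • x + (d * m) • (e • (1 : Hat R))) := by
      funext x
      rw [Adele.smul_def, hc, he]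
      have h1 : (1 : Adele R) = Adele.ι 1 1 := OreLocalization.one_def
      have h2 : Localization.mk c d • Adele.ι m x = Adele.ι (d * m) (c • x) :=
        LocalizedModule.mk_smul_mk ..
      have h3 : Localization.mk e d' • Adele.ι 1 (1 : Hat R) = Adele.ι (d' * 1) (e • 1) :=
        LocalizedModule.mk_smul_mk ..
      rw [h1, h2, h3, mul_smul]
      exact LocalizedModule.mk_add_mk
    rw [h]
    exact (Adele.continuous_ι _).comp (Hat.continuous_affine _ _)

end AffineGroup

section Translation

/-- The action `(α_g f)(x) = f(g⁻¹ x)` on `C₀(X)` induced by an action on `X` by homeomorphisms. -/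
def translation (G X : Type*) [Group G] [TopologicalSpace X] [MulAction G X]
    [ContinuousConstSMul G X] : G →* (C₀(X, ℂ) ≃⋆ₐ[ℂ] C₀(X, ℂ)) where
  toFun g :=
    { toFun := fun f => f.comp (Homeomorph.smul g⁻¹ : X ≃ₜ X).toCocompactMap
      invFun := fun f => f.comp (Homeomorph.smul g : X ≃ₜ X).toCocompactMap
      left_inv := fun f => by ext x; simp
      right_inv := fun f => by ext x; simp
      map_mul' := fun _ _ => rfl
      map_add' := fun _ _ => rfl
      map_star' := fun _ => rfl
      map_smul' := fun _ _ => rfl }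
  map_one' := by ext f x; simp
  map_mul' g h := by
    ext f x
    change f ((g * h)⁻¹ • x) = f (h⁻¹ • g⁻¹ • x)
    rw [mul_inv_rev, mul_smul]

end Translation

/-! ### The adelic crossed product and its corner -/

section Main

/-- The corner `p A p` of a C⋆-algebra, for a self-adjoint element (such as a projection) `p`. -/
def corner {A : Type*} [NonUnitalCStarAlgebra A] (p : A) (hp : IsSelfAdjoint p) :
    NonUnitalStarSubalgebra ℂ A where
  carrier := Set.range fun a => p * a * p
  add_mem' := by
    rintro _ _ ⟨a, rfl⟩ ⟨b, rfl⟩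
    exact ⟨a + b, by simp [mul_add, add_mul]⟩
  zero_mem' := ⟨0, by simp⟩
  mul_mem' := by
    rintro _ _ ⟨a, rfl⟩ ⟨b, rfl⟩
    exact ⟨a * p * p * b, by simp [mul_assoc]⟩
  smul_mem' := by
    rintro c _ ⟨a, rfl⟩
    exact ⟨c • a, by simp [mul_smul_comm, smul_mul_assoc]⟩
  star_mem' := by
    rintro _ ⟨a, rfl⟩
    exact ⟨star a, by simp [hp.star_eq, mul_assoc]⟩

variable (R : Type*) [CommRing R] [IsDomain R]

/-- The crossed product `C₀(𝓡) ⋊ P_{Q(R)}`. -/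
abbrev AdelicCrossedProduct : Type _ :=
  CrossedProduct (translation (AffineGroup (FractionRing R)) (Adele R))

variable [∀ m : R⁰, Finite (R ⧸ Ideal.span {(m : R)})]

variable {R} in
/-- The element `V_g p_{R̂}` of `C₀(𝓡) ⋊ P_{Q(R)}`. -/
def Vp (g : AffineGroup (FractionRing R)) : AdelicCrossedProduct R :=
  CrossedProduct.V _ g (Adele.pHat R)

/-- The projection `p_{R̂}` in the crossed product. -/
def projHat : AdelicCrossedProduct R := CrossedProduct.inclusion _ (Adele.pHat R)

theorem isSelfAdjoint_projHat : IsSelfAdjoint (projHat R) := by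
  have h : star (Adele.pHat R) = Adele.pHat R := by
    ext x
    change star ((Adele.hat R).indicator 1 x) = (Adele.hat R).indicator (1 : Adele R → ℂ) x
    by_cases hx : x ∈ Adele.hat R <;> simp [hx]
  rw [IsSelfAdjoint, projHat, ← map_star, h]

/-- The corner `p_{R̂} (C₀(𝓡) ⋊ P_{Q(R)}) p_{R̂}`. -/
abbrev AdelicCorner : NonUnitalStarSubalgebra ℂ (AdelicCrossedProduct R) :=
  corner (projHat R) (isSelfAdjoint_projHat R)

variable {R}

/-- The matrix with rows `(1, n)` and `(0, 1)`. -/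
def translationBy (n : R) : AffineGroup (FractionRing R) := ⟨1, algebraMap R _ n⟩

/-- The matrix with rows `(m, 0)` and `(0, 1)`. -/
def dilationBy (m : R⁰) : AffineGroup (FractionRing R) :=
  ⟨(IsLocalization.map_units (FractionRing R) m).unit, 0⟩

end Main

end

end RingCStar

open RingCStar

namespace RingCStar

noncomputable section

/-! ### Universal properties -/

/-! Write `p` for the projection of `R̂`, `ω_k` for `StableAlg.of k`, and `(c, r)` for the integral
matrix `affineBy c r`.

The set `R̂` is invariant under translation by elements of `R`, and it is the disjoint union of the
cosets `q + m R̂`, `q ∈ R/(m)`. Hence the elements `V_g p` for integral translations and dilations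
satisfy the relations of `𝔄[R]` with `p` as unit (`adelicRep`), which gives the map `β`. The maps `x
↦ V_k⋆ β(x) V_k` respect the connecting maps, because `V_{lk}⋆ V_l = V_k⋆`, and so they define `Φ`
(`stableToCrossed`).

Injectivity of `Φ` comes from a left inverse with values in the multiplier algebra of `𝔄(R)`. In the
limit the isometries `s_m` become unitary: `ω_i(s_m)` and `ω_i(u^{in})` converge strictly along the
divisibility order to unitary multipliers (`exists_dilation`, `exists_translation`), and these
generate a representation `U` of the `ax + b`-group, since each of its elements is a fraction `d⁻¹
(c, r)` with integral numerator and denominator (`affineLift`). The projection `e = ω_1(1)` is fixed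
by the translations and is the sum of its conjugates by `(m, q)`, just as `p` is. To obtain a
representation of `C₀(𝓡)` from this, the pairs `(α_g p, U_g e U_g⋆)` are considered in `C₀(𝓡) × M`.
For a fixed denominator and modulus they are orthogonal projections, so they define a copy of a
finite-dimensional commutative algebra on which the first coordinate is isometric and the second
contractive (`norm_snd_le_of_mem_graph`). These algebras are directed, and step functions are dense
in `C₀(𝓡)`, so the closure of their union is the graph of a ⋆-homomorphism. The graph is invariant
under the group, which is covariance. On `Φ(𝔄(R))` the integrated form is the canonical embedding
into the multipliers (`integrated_stableToCrossed`).

Surjectivity: being injective, `Φ` has closed range. One has `V_g α_h(p) = V_{gh} p (V_h p)⋆`; after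
passing to a common denominator `k` for `gh` and `h` this is the image of an element `ω_k(u^r s_c
(u^{r'} s_{c'})⋆)`, and density of step functions gives the rest.

For the corner, `Φ ∘ ω_1 = β`, the map `ω_1` is isometric because the connecting maps are injective,
and `e 𝔄(R) e = ω_1(𝔄[R])`, since compressing `ω_k(x)` by `e` yields `ω_1(s_k⋆ x s_k)`. -/

theorem continuous_hom {A B : Type*} [NonUnitalCStarAlgebra A] [NonUnitalCStarAlgebra B]
    (φ : A →⋆ₙₐ[ℂ] B) : Continuous φ :=
  AddMonoidHomClass.continuous_of_bound φ 1 fun a => by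
    rw [one_mul]
    exact NonUnitalStarAlgHom.norm_apply_le φ a

namespace CStarSeminorm

/-- The norm of a C⋆-algebra as a C⋆-seminorm. -/
def ofNorm (B : Type*) [NonUnitalCStarAlgebra B] : CStarSeminorm B where
  toSeminorm := normSeminorm ℂ B
  mul_le := norm_mul_le
  star_mul_self a := by
    rw [sq]
    exact CStarRing.norm_star_mul_self

variable {A B : Type*} [NonUnitalRing A] [StarRing A] [Module ℂ A] [NonUnitalCStarAlgebra B]
  (q : CStarSeminorm A)

theorem hom_ext_of_dense [StarModule ℂ A] [IsScalarTower ℂ A A] [SMulCommClass ℂ A A]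
    {φ ψ : q.Compl →⋆ₙₐ[ℂ] B} (h : ∀ a, φ (q.coe a) = ψ (q.coe a)) : φ = ψ :=
  DFunLike.ext _ _ fun x => q.ind x
    (isClosed_eq (continuous_hom φ) (continuous_hom ψ)) h

variable (φ : A →⋆ₙₐ[ℂ] B) (hφ : ∀ a, ‖φ a‖ ≤ q a)

theorem uniformContinuous_pre (hφ : ∀ a, ‖φ a‖ ≤ q a) :
    UniformContinuous (fun a : q.Pre => φ a : q.Pre → B) :=
  AddMonoidHomClass.uniformContinuous_of_bound
    (⟨⟨fun a => φ a, map_zero φ⟩, map_add φ⟩ : q.Pre →+ B) 1 fun a => by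
      rw [one_mul]
      exact hφ a

/-- A ⋆-homomorphism bounded by the C⋆-seminorm `q` extends to the completion. -/
def lift : q.Compl →⋆ₙₐ[ℂ] B :=
  let F : q.Compl → B := UniformSpace.Completion.extension (α := q.Pre) (fun a => φ a)
  have hF : Continuous F := UniformSpace.Completion.continuous_extension
  have hc : ∀ a, F (q.coe a) = φ a :=
    UniformSpace.Completion.extension_coe (α := q.Pre) (q.uniformContinuous_pre φ hφ)
  { toFun := F
    map_smul' := fun c x => q.ind x
      (isClosed_eq (hF.comp (continuous_const_smul c)) (hF.const_smul c)) fun a => by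
        change F (c • q.coe a) = c • F (q.coe a)
        rw [← coe_smul, hc, hc, map_smul]
    map_zero' := by
      rw [← q.coe_zero, hc, map_zero]
    map_add' := fun x y => q.ind₂ x y (isClosed_eq (hF.comp continuous_add)
      ((hF.comp continuous_fst).add (hF.comp continuous_snd))) fun a b => by
        rw [← coe_add, hc, hc, hc, map_add]
    map_mul' := fun x y => q.ind₂ x y (isClosed_eq (hF.comp continuous_mul)
      ((hF.comp continuous_fst).mul (hF.comp continuous_snd))) fun a b => by
        rw [← coe_mul, hc, hc, hc, map_mul]
    map_star' := fun x => q.ind x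
      (isClosed_eq (hF.comp q.continuous_star_compl) (continuous_star.comp hF)) fun a => by
        rw [← coe_star, hc, hc, map_star] }

theorem lift_coe (a : A) : q.lift φ hφ (q.coe a) = φ a :=
  UniformSpace.Completion.extension_coe (α := q.Pre) (q.uniformContinuous_pre φ hφ) a

end CStarSeminorm

section Universal

variable {A B : Type*} [NonUnitalRing A] [StarRing A] [Module ℂ A] [NonUnitalCStarAlgebra B]
  {rels : Set A} (h : IsBounded A rels)

/-- The norm pulled back along `φ` is one of the C⋆-seminorms over which the supremum is taken. -/
theorem norm_le_maxSeminorm (φ : A →⋆ₙₐ[ℂ] B) (hφ : ∀ x ∈ rels, φ x = 0) (a : A) :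
    ‖φ a‖ ≤ maxSeminorm h a :=
  le_ciSup (h a) ⟨(CStarSeminorm.ofNorm B).comap φ, fun x hx => by
    change ‖φ x‖ = 0
    rw [hφ x hx, norm_zero]⟩

/-- The universal property of the universal C⋆-algebra. -/
def UniversalCStar.lift (φ : A →⋆ₙₐ[ℂ] B) (hφ : ∀ x ∈ rels, φ x = 0) :
    UniversalCStar h →⋆ₙₐ[ℂ] B :=
  (maxSeminorm h).lift φ (norm_le_maxSeminorm h φ hφ)

theorem UniversalCStar.lift_coe (φ : A →⋆ₙₐ[ℂ] B) (hφ : ∀ x ∈ rels, φ x = 0) (a : A) :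
    UniversalCStar.lift h φ hφ ((maxSeminorm h).coe a) = φ a :=
  CStarSeminorm.lift_coe _ _ _ a

end Universal

/-! ### Covariant pairs and calculus in the crossed product -/

section CrossedProductLift

variable {G A M : Type*} [Group G] [NonUnitalCStarAlgebra A] [CStarAlgebra M]
  {α : G →* (A ≃⋆ₐ[ℂ] A)} (π : A →⋆ₙₐ[ℂ] M) (U : G →* unitary M)
  (hU : ∀ g a, (U g : M) * π a = π (α g a) * U g)

/-- The integrated form of a pair `(π, U)` as an additive map on the algebraic crossed product. -/
def AlgCrossedProduct.liftAddHom (α : G →* (A ≃⋆ₐ[ℂ] A)) (π : A →⋆ₙₐ[ℂ] M) (U : G →* unitary M) :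
    AlgCrossedProduct α →+ M :=
  Finsupp.liftAddHom fun g => (AddMonoidHom.mulRight (U g : M)).comp (π : A →+ M)

theorem AlgCrossedProduct.liftAddHom_single (g : G) (a : A) :
    liftAddHom α π U (single α g a) = π a * U g :=
  Finsupp.liftAddHom_apply_single
    (fun g => (AddMonoidHom.mulRight (U g : M)).comp (π : A →+ M)) g a

/-- The integrated form of a covariant pair on the algebraic crossed product. -/
def AlgCrossedProduct.lift : AlgCrossedProduct α →⋆ₙₐ[ℂ] M where
  toFun := liftAddHom α π U
  map_zero' := map_zero _
  map_add' := map_add _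
  map_smul' c x := by
    refine ind x (fun g a => ?_) fun x y hx hy => ?_
    · rw [smul_single, liftAddHom_single, liftAddHom_single, map_smul, smul_mul_assoc]
      rfl
    · rw [smul_add, map_add, hx, hy, map_add, smul_add]
  map_mul' x y := by
    refine ind x (fun s a => ?_) fun x₁ x₂ h₁ h₂ => by rw [add_mul, map_add, h₁, h₂, map_add, add_mul]
    refine ind y (fun t b => ?_) fun x₁ x₂ h₁ h₂ => by rw [mul_add, map_add, h₁, h₂, map_add, mul_add]
    rw [single_mul_single, liftAddHom_single, liftAddHom_single, liftAddHom_single, map_mul,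
      map_mul, Submonoid.coe_mul, mul_assoc, mul_assoc, ← mul_assoc (π (α s b)), ← hU, mul_assoc]
  map_star' x := by
    refine ind x (fun s a => ?_) fun x₁ x₂ h₁ h₂ => by rw [star_add, map_add, h₁, h₂, map_add, star_add]
    rw [star_single, liftAddHom_single, liftAddHom_single, star_mul, ← map_star, ← hU, map_inv]
    rfl

/-- The integrated form of a covariant pair. -/
def CrossedProduct.lift : CrossedProduct α →⋆ₙₐ[ℂ] M :=
  UniversalCStar.lift (AlgCrossedProduct.isBounded α) (AlgCrossedProduct.lift π U hU)
    fun _ h => h.elim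

theorem CrossedProduct.lift_V (g : G) (a : A) :
    CrossedProduct.lift π U hU (CrossedProduct.V α g a) = U g * π a := by
  rw [hU]
  exact (UniversalCStar.lift_coe (AlgCrossedProduct.isBounded α) (AlgCrossedProduct.lift π U hU)
    (fun _ h => h.elim) _).trans (AlgCrossedProduct.liftAddHom_single π U g (α g a))

/-- The elements `V_g a` span a dense subspace of the crossed product. -/
theorem CrossedProduct.ind {P : CrossedProduct α → Prop} (x : CrossedProduct α)
    (hc : IsClosed {x | P x}) (hV : ∀ g a, P (V α g a)) (hadd : ∀ x y, P x → P y → P (x + y)) :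
    P x := by
  refine (maxSeminorm (AlgCrossedProduct.isBounded α)).ind x hc fun a => ?_
  refine AlgCrossedProduct.ind a (fun g a => ?_) fun x y hx hy => ?_
  -- The formal product `a · V_g` is `V_g α_{g⁻¹}(a)`.
  · have h := hV g (α g⁻¹ a)
    rwa [V, ← StarAlgEquiv.mul_apply, ← map_mul, mul_inv_cancel, map_one,
      StarAlgEquiv.one_apply] at h
  · rw [CStarSeminorm.coe_add]
    exact hadd _ _ hx hy

/-- Covariance moves `a` to the right of `V_h`. Calculations use products `V_g a`, since the
unitaries `V_g` alone are only multipliers of the crossed product. -/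
theorem CrossedProduct.V_mul_V (g h : G) (a b : A) :
    V α g a * V α h b = V α (g * h) (α h⁻¹ a * b) := by
  refine (map_mul (maxSeminorm (AlgCrossedProduct.isBounded α)).toCompl _ _).symm.trans ?_
  rw [AlgCrossedProduct.single_mul_single, V, map_mul (α (g * h))]
  congr 3
  · rw [← StarAlgEquiv.mul_apply, ← map_mul, mul_inv_cancel_right]
  · rw [map_mul, StarAlgEquiv.mul_apply]

theorem CrossedProduct.star_V (g : G) (a : A) : star (V α g a) = V α g⁻¹ (α g (star a)) := by
  refine (map_star (maxSeminorm (AlgCrossedProduct.isBounded α)).toCompl _).symm.trans ?_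
  rw [AlgCrossedProduct.star_single, V, map_star (α g)]

theorem CrossedProduct.V_add (g : G) (a b : A) : V α g (a + b) = V α g a + V α g b := by
  rw [V, map_add, map_add, map_add]; rfl

theorem CrossedProduct.V_smul (g : G) (c : ℂ) (a : A) : V α g (c • a) = c • V α g a := by
  rw [V, map_smul, ← AlgCrossedProduct.smul_single, map_smul]; rfl

theorem CrossedProduct.V_one (a : A) : V α 1 a = inclusion α a := by
  rw [V, map_one]; rfl

end CrossedProductLift

/-! ### Universal property of the free ⋆-algebra -/

section Free

variable {X C : Type*} [Ring C] [StarRing C] [Algebra ℂ C] [StarModule ℂ C]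

/-- The universal property of the free ⋆-algebra. -/
def FreeStarAlgebra.lift (f : X → C) : FreeStarAlgebra X →⋆ₐ[ℂ] C :=
  let F : FreeStarAlgebra X →ₐ[ℂ] C := FreeAlgebra.lift ℂ (Sum.elim f fun x => star (f x))
  have hF : ∀ x, F (letter x) = Sum.elim f (fun x => star (f x)) x :=
    FreeAlgebra.lift_ι_apply (Sum.elim f fun x => star (f x))
  { F with
    map_star' := fun a => by
      change F (star a) = star (F a)
      refine ind a (fun c => ?_) (fun x => ?_) (fun a b ha hb => ?_) fun a b ha hb => ?_
      · rw [star_algebraMap, AlgHom.commutes, AlgHom.commutes, algebraMap_star_comm]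
      · rw [star_letter, hF, hF]
        cases x <;> simp
      · rw [star_mul, map_mul, ha, hb, map_mul, star_mul]
      · rw [star_add, map_add, ha, hb, map_add, star_add] }

theorem FreeStarAlgebra.lift_gen (f : X → C) (x : X) : lift f (gen x) = f x :=
  FreeAlgebra.lift_ι_apply (Sum.elim f fun x => star (f x)) (Sum.inl x)

end Free

/-! ### Representations of the defining relations in corners -/

section Corner

variable {A : Type*} [NonUnitalCStarAlgebra A] {p : A} (hp : IsSelfAdjoint p)

theorem mul_mem_corner (h : IsIdempotentElem p) {x : A} (hx : x ∈ corner p hp) :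
    p * x = x ∧ x * p = x := by
  obtain ⟨a, rfl⟩ := hx
  have h : p * p = p := h
  exact ⟨by simp only [← mul_assoc, h], by simp only [mul_assoc, h]⟩

theorem mem_corner {x : A} (h₁ : p * x = x) (h₂ : x * p = x) : x ∈ corner p hp :=
  ⟨x, by change p * x * p = x; rw [h₁, h₂]⟩

/-- The corner of a projection is a unital ring. -/
@[reducible]
def cornerRing (h : IsIdempotentElem p) : Ring (corner p hp) where
  __ := (inferInstance : NonUnitalRing (corner p hp))
  one := ⟨p, mem_corner hp h h⟩
  one_mul x := Subtype.ext (mul_mem_corner hp h x.2).1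
  mul_one x := Subtype.ext (mul_mem_corner hp h x.2).2

/-- The corner of a projection is a unital algebra. -/
@[reducible]
def cornerAlgebra (h : IsIdempotentElem p) :
    letI := cornerRing hp h
    Algebra ℂ (corner p hp) :=
  letI := cornerRing hp h
  Algebra.ofModule (fun c x y => smul_mul_assoc c x y) (fun c x y => mul_smul_comm c x y)

end Corner

section RingAlg

variable (R : Type*) [CommRing R] (C : Type*) [NonUnitalCStarAlgebra C]

/-- A family of elements of a C⋆-algebra satisfying the defining relations of `𝔄[R]` in the corner
of a projection `e`. -/
structure RingRep where
  e : C
  s : R⁰ → C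
  u : R → C
  star_e : IsSelfAdjoint e
  e_mul_e : e * e = e
  e_mul_s : ∀ m, e * s m = s m
  s_mul_e : ∀ m, s m * e = s m
  e_mul_u : ∀ n, e * u n = u n
  u_mul_e : ∀ n, u n * e = u n
  star_s_mul_s : ∀ m, star (s m) * s m = e
  star_u_mul_u : ∀ n, star (u n) * u n = e
  u_mul_star_u : ∀ n, u n * star (u n) = e
  s_mul_s : ∀ k m, s k * s m = s (k * m)
  u_mul_u : ∀ l n, u l * u n = u (l + n)
  s_mul_u : ∀ m n, s m * u n = u (m * n) * s m
  sum_eq : ∀ m : R⁰, ∑ᶠ q : R ⧸ Ideal.span {(m : R)},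
    u q.out * (s m * star (s m)) * u (-q.out) = e

variable {R C}

namespace RingRep

variable (ρ : RingRep R C)

/-- The generators as elements of the corner. -/
def gen : Gen R → corner ρ.e ρ.star_e
  | .s m => ⟨ρ.s m, mem_corner _ (ρ.e_mul_s m) (ρ.s_mul_e m)⟩
  | .u n => ⟨ρ.u n, mem_corner _ (ρ.e_mul_u n) (ρ.u_mul_e n)⟩

/-- The representation of the free ⋆-algebra in the corner. -/
def freeCorner : FreeStarAlgebra (Gen R) →⋆ₙₐ[ℂ] corner ρ.e ρ.star_e :=
  -- The relations contain the unit of the free algebra, which has to go to `e`; the target is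
  -- therefore the corner, a ring with unit `e`, and not the ambient algebra.
  letI := cornerRing ρ.star_e ρ.e_mul_e
  letI := cornerAlgebra ρ.star_e ρ.e_mul_e
  (FreeStarAlgebra.lift ρ.gen).toNonUnitalStarAlgHom

/-- The representation of the free ⋆-algebra. -/
def free : FreeStarAlgebra (Gen R) →⋆ₙₐ[ℂ] C :=
  (NonUnitalStarSubalgebraClass.subtype (corner ρ.e ρ.star_e)).comp ρ.freeCorner

theorem free_s (m : R⁰) : ρ.free (fs m) = ρ.s m := by
  let _ := cornerRing ρ.star_e ρ.e_mul_e
  let _ := cornerAlgebra ρ.star_e ρ.e_mul_e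
  exact congrArg Subtype.val (FreeStarAlgebra.lift_gen ρ.gen (.s m))

theorem free_u (n : R) : ρ.free (fu n) = ρ.u n := by
  let _ := cornerRing ρ.star_e ρ.e_mul_e
  let _ := cornerAlgebra ρ.star_e ρ.e_mul_e
  exact congrArg Subtype.val (FreeStarAlgebra.lift_gen ρ.gen (.u n))

theorem free_one : ρ.free 1 = ρ.e := by
  let _ := cornerRing ρ.star_e ρ.e_mul_e
  let _ := cornerAlgebra ρ.star_e ρ.e_mul_e
  exact congrArg Subtype.val (map_one (FreeStarAlgebra.lift ρ.gen))

variable [∀ m : R⁰, Finite (R ⧸ Ideal.span {(m : R)})]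

theorem free_rel (x : FreeStarAlgebra (Gen R)) (hx : Rel R x) : ρ.free x = 0 := by
  cases hx with
  | isometry m => rw [map_sub, map_mul, map_star, free_s, free_one, star_s_mul_s, sub_self]
  | unitary_left n => rw [map_sub, map_mul, map_star, free_u, free_one, star_u_mul_u, sub_self]
  | unitary_right n => rw [map_sub, map_mul, map_star, free_u, free_one, u_mul_star_u, sub_self]
  | s_mul k m => rw [map_sub, map_mul, free_s, free_s, free_s, s_mul_s, sub_self]
  | u_mul k m => rw [map_sub, map_mul, free_u, free_u, free_u, u_mul_u, sub_self]
  | s_mul_u m n => rw [map_sub, map_mul, map_mul, free_u, free_u, free_s, s_mul_u, sub_self]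
  | sum_eq_one m =>
    have := Fintype.ofFinite (R ⧸ Ideal.span {(m : R)})
    have h := ρ.sum_eq m
    rw [finsum_eq_sum_of_fintype] at h
    rw [finsum_eq_sum_of_fintype, map_sub, map_sum, free_one, ← h, sub_eq_zero]
    exact Finset.sum_congr rfl fun q _ => by
      simp only [map_mul, map_star, free_u, free_s]

/-- The representation of `𝔄[R]` defined by elements that satisfy the relations. -/
def lift : RingAlg R →⋆ₙₐ[ℂ] C :=
  UniversalCStar.lift (rel_isBounded R) ρ.free ρ.free_rel

theorem lift_of (x : FreeStarAlgebra (Gen R)) : ρ.lift (RingAlg.of x) = ρ.free x :=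
  UniversalCStar.lift_coe (rel_isBounded R) ρ.free ρ.free_rel x

theorem lift_s (m : R⁰) : ρ.lift (RingAlg.s m) = ρ.s m := (ρ.lift_of _).trans (ρ.free_s m)
theorem lift_u (n : R) : ρ.lift (RingAlg.u n) = ρ.u n := (ρ.lift_of _).trans (ρ.free_u n)
theorem lift_one : ρ.lift 1 = ρ.e := (ρ.lift_of _).trans ρ.free_one

end RingRep

namespace RingAlg

theorem hom_ext {φ ψ : RingAlg R →⋆ₙₐ[ℂ] C} (hs : ∀ m, φ (s m) = ψ (s m))
    (hu : ∀ n, φ (u n) = ψ (u n)) : φ = ψ := by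
  refine CStarSeminorm.hom_ext_of_dense (maxSeminorm (rel_isBounded R)) fun a => ?_
  change φ (of a) = ψ (of a)
  refine FreeStarAlgebra.ind a (fun c => ?_) (fun x => ?_) (fun a b ha hb => ?_) fun a b ha hb => ?_
  -- Scalars are covered by the generators, because the unit is `s_1`.
  · have h := hs 1
    rw [s_one] at h
    have h1 : (of (algebraMap ℂ _ c) : RingAlg R) = c • 1 := by
      rw [Algebra.algebraMap_eq_smul_one, map_smul]; rfl
    rw [h1, map_smul, map_smul, h]
  · have key : ∀ x : Gen R, φ (of (.gen x)) = ψ (of (.gen x)) := by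
      rintro (m | n)
      · exact hs m
      · exact hu n
    rcases x with x | x
    · exact key x
    · have h1 : (FreeStarAlgebra.letter (Sum.inr x) : FreeStarAlgebra (Gen R)) = star (.gen x) :=
        (FreeStarAlgebra.star_letter (Sum.inl x)).symm
      rw [h1, map_star, map_star, map_star, key]
  · rw [map_mul, map_mul, map_mul, ha, hb]
  · rw [map_add, map_add, map_add, ha, hb]

theorem star_one' : star (1 : RingAlg R) = 1 := by
  change star (of 1) = of 1
  rw [← map_star, star_one]

theorem mul_one' (x : RingAlg R) : x * 1 = x := by
  have h := congrArg star (one_mul' (star x))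
  rwa [star_mul, star_star, star_one'] at h

theorem star_u_mul_u (n : R) : star (u n) * u n = (1 : RingAlg R) := by
  rw [u, ← map_star, ← map_mul]
  exact of_eq (Rel.unitary_left n)

theorem u_mul_star_u (n : R) : u n * star (u n) = (1 : RingAlg R) := by
  rw [u, ← map_star, ← map_mul]
  exact of_eq (Rel.unitary_right n)

theorem u_mul_u (l n : R) : u l * u n = (u (l + n) : RingAlg R) := by
  rw [u, u, ← map_mul]
  exact of_eq (Rel.u_mul l n)

theorem s_mul_u (m : R⁰) (n : R) : s m * u n = (u (m * n) * s m : RingAlg R) := by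
  rw [s, u, u, ← map_mul, ← map_mul]
  exact of_eq (Rel.s_mul_u m n)

theorem u_zero : (u 0 : RingAlg R) = 1 := by
  have h := congrArg (star (u (0 : R)) * ·) (u_mul_u (0 : R) 0)
  simp only [← mul_assoc, star_u_mul_u, add_zero, one_mul'] at h
  exact h

theorem star_u (n : R) : star (u n) = (u (-n) : RingAlg R) := by
  rw [← mul_one' (star (u n)), ← u_zero, ← add_neg_cancel n, ← u_mul_u, ← mul_assoc, star_u_mul_u,
    one_mul']

theorem sum_eq_one (m : R⁰) [Fintype (R ⧸ Ideal.span {(m : R)})] :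
    ∑ q : R ⧸ Ideal.span {(m : R)}, u q.out * (s m * star (s m)) * star (u q.out) =
      (1 : RingAlg R) := by
  have h := of_eq (Rel.sum_eq_one m)
  rw [finsum_eq_sum_of_fintype, map_sum] at h
  refine Eq.trans (Finset.sum_congr rfl fun q _ => ?_) h
  rw [star_u, map_mul, map_mul, map_mul, map_star]
  rfl

/-- From `‖1‖² = ‖1‖`; the inequality needs no argument that the algebra is nonzero and suffices for
uniform bounds on the generators. -/
theorem norm_one_le : ‖(1 : RingAlg R)‖ ≤ 1 := by
  have h := CStarRing.norm_star_mul_self (x := (1 : RingAlg R))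
  rw [star_one', one_mul'] at h
  nlinarith [norm_nonneg (1 : RingAlg R)]

theorem norm_le_one_of_star_mul_self {x : RingAlg R} (hx : star x * x = 1) : ‖x‖ ≤ 1 := by
  have h := CStarRing.norm_star_mul_self (x := x)
  rw [hx] at h
  nlinarith [norm_nonneg x, norm_one_le (R := R)]

end RingAlg

end RingAlg

/-! ### The stabilization -/

namespace RingAlg

variable {R : Type*} [CommRing R]

/-- The compression `z ↦ s_l⋆ z s_l` is a left inverse. -/
theorem conj_injective (l : R⁰) : Function.Injective (conj l : RingAlg R → RingAlg R) := by
  intro x y h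
  have key : ∀ z : RingAlg R, star (s l) * conj l z * s l = z := fun z => by
    change star (s l) * (s l * z * star (s l)) * s l = z
    rw [mul_assoc, mul_assoc, star_s_mul_s, mul_one', ← mul_assoc, star_s_mul_s, one_mul']
  rw [← key x, h, key]

end RingAlg

namespace StableAlg

variable {R : Type*} [CommRing R]

theorem toDirectLimit_conj (k l : R⁰) (x : RingAlg R) :
    toDirectLimit (F := fun _ : DivIndex R => RingAlg R) connect ⟨l * k⟩ (RingAlg.conj l x) =
      toDirectLimit (F := fun _ : DivIndex R => RingAlg R) connect ⟨k⟩ x := by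
  have h : (⟨k⟩ : DivIndex R) ≤ ⟨l * k⟩ := ⟨l, rfl⟩
  rw [← connect_eq ⟨k⟩ ⟨l * k⟩ h l rfl]
  exact DirectLimit.mk_apply (F := fun _ : DivIndex R => RingAlg R) (f := connect) _ _ x h

theorem of_conj (k l : R⁰) (x : RingAlg R) : of (l * k) (RingAlg.conj l x) = of k x :=
  congrArg (maxSeminorm (directLimit_isBounded _)).toCompl (toDirectLimit_conj k l x)

@[elab_as_elim]
theorem ind {P : StableAlg R → Prop} (x : StableAlg R) (hc : IsClosed {x | P x})
    (h : ∀ k x, P (of k x)) : P x := by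
  refine (maxSeminorm (directLimit_isBounded (F := fun _ : DivIndex R => RingAlg R)
    connect)).ind x hc fun a => ?_
  induction a using DirectLimit.induction with
  | ih i x => exact h i.val x

theorem dense_range_of : Dense {x : StableAlg R | ∃ k y, x = of k y} := fun x =>
  ind (P := fun x => x ∈ closure {x : StableAlg R | ∃ k y, x = of k y}) x isClosed_closure
    fun k y => subset_closure ⟨k, y, rfl⟩

/-! ### Isometry of the canonical maps -/

section Norm

/-- The norm of the algebraic inductive limit. -/
def limitNorm : DirectLimit (fun _ : DivIndex R => RingAlg R) connect → ℝ :=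
  DirectLimit.lift connect (fun _ x => ‖x‖) fun _ _ h x =>
    -- Compatibility: the connecting maps are injective ⋆-homomorphisms, hence isometric.
    (NonUnitalStarAlgHom.norm_map _ (RingAlg.conj_injective h.choose) x).symm

/-- The norm of the algebraic inductive limit is a C⋆-seminorm. -/
def limitSeminorm : CStarSeminorm (DirectLimit (fun _ : DivIndex R => RingAlg R) connect) where
  toSeminorm := Seminorm.ofSMulLE limitNorm
    ((congrArg limitNorm (map_zero (toDirectLimit (F := fun _ : DivIndex R => RingAlg R)
      connect ⟨1⟩)).symm).trans norm_zero)
    (fun a b => by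
      obtain ⟨i, x, y, rfl, rfl⟩ := DirectLimit.exists_eq_mk₂ _ a b
      change limitNorm (toDirectLimit connect i x + toDirectLimit connect i y) ≤ ‖x‖ + ‖y‖
      rw [← map_add]
      exact norm_add_le x y)
    (fun c a => by
      obtain ⟨i, x, rfl⟩ := DirectLimit.exists_eq_mk _ a
      change limitNorm (c • toDirectLimit connect i x) ≤ ‖c‖ * ‖x‖
      rw [← map_smul]
      exact norm_smul_le c x)
  mul_le a b := by
    obtain ⟨i, x, y, rfl, rfl⟩ := DirectLimit.exists_eq_mk₂ _ a b
    change limitNorm (toDirectLimit connect i x * toDirectLimit connect i y) ≤ ‖x‖ * ‖y‖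
    rw [← map_mul]
    exact norm_mul_le x y
  star_mul_self a := by
    obtain ⟨i, x, rfl⟩ := DirectLimit.exists_eq_mk _ a
    change limitNorm (star (toDirectLimit connect i x) * toDirectLimit connect i x) = ‖x‖ ^ 2
    rw [← map_star, ← map_mul, sq]
    exact CStarRing.norm_star_mul_self

/-- The norm of the algebraic limit is itself a C⋆-seminorm, hence a lower bound for the largest
one; so completing loses nothing. -/
theorem norm_of (k : R⁰) (x : RingAlg R) : ‖of k x‖ = ‖x‖ := by
  refine le_antisymm (NonUnitalStarAlgHom.norm_apply_le (of k) x) ?_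
  refine le_of_le_of_eq ?_ ((maxSeminorm (directLimit_isBounded (F := fun _ : DivIndex R =>
    RingAlg R) connect)).norm_coe (toDirectLimit connect ⟨k⟩ x)).symm
  exact le_ciSup (directLimit_isBounded (F := fun _ : DivIndex R => RingAlg R) connect
    (toDirectLimit connect ⟨k⟩ x)) ⟨limitSeminorm, fun _ h => h.elim⟩

end Norm

/-! ### Maps out of the stabilization -/

section Lift

variable {C : Type*} [NonUnitalCStarAlgebra C] (φ : R⁰ → RingAlg R →⋆ₙₐ[ℂ] C)
  (h : ∀ k l x, φ (l * k) (RingAlg.conj l x) = φ k x)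

/-- The universal property of the algebraic inductive limit. -/
def limitLift : DirectLimit (fun _ : DivIndex R => RingAlg R) connect →⋆ₙₐ[ℂ] C :=
  let F : DirectLimit (fun _ : DivIndex R => RingAlg R) connect → C :=
    DirectLimit.lift connect (fun i x => φ i.val x) fun i j hij x => by
      obtain ⟨l, hl⟩ := id hij
      rw [connect_eq i j hij l hl, hl, h]
  have hF : ∀ i x, F (toDirectLimit connect i x) = φ i.val x := fun _ _ => rfl
  { toFun := F
    map_smul' := fun c a => by
      obtain ⟨i, x, rfl⟩ := DirectLimit.exists_eq_mk _ a
      change F (c • toDirectLimit connect i x) = c • F (toDirectLimit connect i x)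
      rw [← map_smul, hF, hF, map_smul]
    map_zero' := by
      rw [← map_zero (toDirectLimit (F := fun _ : DivIndex R => RingAlg R) connect ⟨1⟩), hF,
        map_zero]
    map_add' := fun a b => by
      obtain ⟨i, x, y, rfl, rfl⟩ := DirectLimit.exists_eq_mk₂ _ a b
      change F (toDirectLimit connect i x + toDirectLimit connect i y) =
        F (toDirectLimit connect i x) + F (toDirectLimit connect i y)
      rw [← map_add, hF, hF, hF, map_add]
    map_mul' := fun a b => by
      obtain ⟨i, x, y, rfl, rfl⟩ := DirectLimit.exists_eq_mk₂ _ a b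
      change F (toDirectLimit connect i x * toDirectLimit connect i y) =
        F (toDirectLimit connect i x) * F (toDirectLimit connect i y)
      rw [← map_mul, hF, hF, hF, map_mul]
    map_star' := fun a => by
      obtain ⟨i, x, rfl⟩ := DirectLimit.exists_eq_mk _ a
      change F (star (toDirectLimit connect i x)) = star (F (toDirectLimit connect i x))
      rw [← map_star, hF, hF, map_star] }

/-- The universal property of the stabilization. -/
def lift : StableAlg R →⋆ₙₐ[ℂ] C :=
  UniversalCStar.lift (directLimit_isBounded _) (limitLift φ h) fun _ h => h.elim

theorem lift_of (k : R⁰) (x : RingAlg R) : lift φ h (of k x) = φ k x :=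
  UniversalCStar.lift_coe (directLimit_isBounded _) (limitLift φ h) (fun _ h => h.elim)
    (toDirectLimit connect ⟨k⟩ x)

end Lift

end StableAlg

/-! ### Multipliers as strict limits -/

section Strict

open Filter Topology

variable {ι A : Type*} [NonUnitalCStarAlgebra A] {l : Filter ι} [l.NeBot]

/-- A bounded family of operators which converges pointwise on a dense set converges pointwise to a
bounded operator. -/
theorem exists_tendsto_of_dense {f : ι → A →L[ℂ] A} {C : ℝ} (hC : ∀ i, ‖f i‖ ≤ C) {D : Set A}
    (hD : Dense D) (h : ∀ x ∈ D, ∃ y, Tendsto (fun i => f i x) l (𝓝 y)) :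
    ∃ F : A →L[ℂ] A, ∀ x, Tendsto (fun i => f i x) l (𝓝 (F x)) := by
  have hC0 : 0 ≤ C := by
    obtain ⟨i⟩ := l.nonempty_of_neBot
    exact (norm_nonneg _).trans (hC i)
  have key : ∀ x, ∃ y, Tendsto (fun i => f i x) l (𝓝 y) := by
    intro x
    rw [← cauchy_map_iff_exists_tendsto, Metric.cauchy_iff]
    refine ⟨inferInstance, fun ε hε => ?_⟩
    -- The Cauchy estimate has four terms of size `ε / 4`: two for replacing `x` by `z` and two
    -- distances to the limit `y`. Using `C + 1` avoids division by zero.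
    obtain ⟨z, hz, hxz⟩ := Metric.dense_iff.1 hD x (ε / (4 * (C + 1))) (by positivity)
    obtain ⟨y, hy⟩ := h z hxz
    have hb : ∀ i, dist (f i x) (f i z) < ε / 4 := fun i => by
      rw [dist_eq_norm, ← map_sub]
      refine ((f i).le_opNorm _).trans_lt ?_
      have h1 : ‖x - z‖ < ε / (4 * (C + 1)) := by
        rw [← dist_eq_norm, dist_comm]; exact hz
      have h2 : ‖f i‖ * ‖x - z‖ ≤ C * (ε / (4 * (C + 1))) :=
        mul_le_mul (hC i) h1.le (norm_nonneg _) hC0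
      refine h2.trans_lt ?_
      have h3 : C * (ε / (4 * (C + 1))) = ε / 4 * (C / (C + 1)) := by field_simp
      rw [h3]
      exact mul_lt_of_lt_one_right (by positivity) ((div_lt_one (by positivity)).2 (by linarith))
    refine ⟨_, image_mem_map (Metric.tendsto_nhds.1 hy (ε / 4) (by positivity)), ?_⟩
    rintro _ ⟨i, hi, rfl⟩ _ ⟨j, hj, rfl⟩
    have h1 : dist (f i z) y < ε / 4 := hi
    have h2 : dist (f j z) y < ε / 4 := hj
    have h3 := dist_triangle4 (f i x) (f i z) (f j z) (f j x)
    have h4 := dist_triangle_right (f i z) (f j z) y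
    have h5 := hb j
    rw [dist_comm] at h5
    linarith [hb i]
  choose F hF using key
  let F' : A →ₗ[ℂ] A :=
    { toFun := F
      map_add' := fun x y => tendsto_nhds_unique (hF (x + y)) <| by
        simp only [map_add]; exact (hF x).add (hF y)
      map_smul' := fun c x => tendsto_nhds_unique (hF (c • x)) <| by
        simp only [map_smul]; exact (hF x).const_smul c }
  exact ⟨F'.mkContinuous C fun x => le_of_tendsto (hF x).norm
    (Eventually.of_forall fun i => (f i).le_of_opNorm_le (hC i) x), hF⟩

/-- A bounded family which converges strictly on a dense set has a strict limit in the multiplier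
algebra. -/
theorem exists_multiplier {a : ι → A} {C : ℝ} (hC : ∀ i, ‖a i‖ ≤ C) {D : Set A} (hD : Dense D)
    (hl : ∀ x ∈ D, ∃ y, Tendsto (fun i => a i * x) l (𝓝 y))
    (hr : ∀ x ∈ D, ∃ y, Tendsto (fun i => x * a i) l (𝓝 y)) :
    ∃ T : DoubleCentralizer ℂ A, ∀ x, Tendsto (fun i => a i * x) l (𝓝 (T.fst x)) ∧
      Tendsto (fun i => x * a i) l (𝓝 (T.snd x)) := by
  obtain ⟨F, hF⟩ := exists_tendsto_of_dense (f := fun i => ContinuousLinearMap.mul ℂ A (a i))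
    (fun i => (ContinuousLinearMap.opNorm_mul_apply_le ℂ A (a i)).trans (hC i)) hD hl
  obtain ⟨G, hG⟩ := exists_tendsto_of_dense
    (f := fun i => (ContinuousLinearMap.mul ℂ A).flip (a i)) (fun i =>
      (ContinuousLinearMap.opNorm_le_bound _ (norm_nonneg _) fun x => by
        rw [mul_comm]; exact norm_mul_le x (a i)).trans (hC i)) hD hr
  refine ⟨⟨(F, G), fun x y => ?_⟩, fun x => ⟨hF x, hG x⟩⟩
  -- The double centralizer identity `G(x) y = x F(y)`: both sides are limits of `x a_i y`,
  -- bracketed differently.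
  have h1 : Tendsto (fun i => x * a i * y) l (𝓝 (G x * y)) := (hG x).mul_const y
  have h2 : Tendsto (fun i => x * (a i * y)) l (𝓝 (x * F y)) := (hF y).const_mul x
  simp only [← mul_assoc] at h2
  exact tendsto_nhds_unique h1 h2

/-- The norm of a multiplier equals the norm of its left component, so the left action on a dense
set determines it. -/
theorem multiplier_ext {T T' : DoubleCentralizer ℂ A} {D : Set A} (hD : Dense D)
    (h : ∀ x ∈ D, T.fst x = T'.fst x) : T = T' := by
  have h1 : T.fst = T'.fst := DFunLike.coe_injective
    (Continuous.ext_on hD T.fst.continuous T'.fst.continuous h)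
  rw [← sub_eq_zero, ← norm_eq_zero, ← DoubleCentralizer.norm_fst, DoubleCentralizer.sub_fst, h1,
    sub_self, norm_zero]

theorem multiplier_mul_coe (T : DoubleCentralizer ℂ A) (a : A) :
    T * DoubleCentralizer.coeHom a = DoubleCentralizer.coeHom (𝕜 := ℂ) (T.fst a) := by
  refine multiplier_ext dense_univ fun x _ => ?_
  have : T.fst (a * x) = T.fst a * x := by
    -- Centrality gives `T(ax) = T(a)x` only after left multiplication by an arbitrary `z`; taking
    -- for `z` the adjoint of the difference, the C⋆-identity removes it.
    have h : ∀ z : A, z * T.fst (a * x) = z * (T.fst a * x) := fun z => by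
      rw [← T.central, ← mul_assoc, T.central, mul_assoc]
    have h1 := h (star (T.fst (a * x) - T.fst a * x))
    rw [← sub_eq_zero, ← mul_sub, CStarRing.star_mul_self_eq_zero_iff, sub_eq_zero] at h1
    exact h1
  exact this

theorem coe_mul_multiplier (T : DoubleCentralizer ℂ A) (a : A) :
    DoubleCentralizer.coeHom a * T = DoubleCentralizer.coeHom (𝕜 := ℂ) (T.snd a) := by
  refine multiplier_ext dense_univ fun x _ => ?_
  exact (T.central a x).symm

/-- Apply the left multiplication by `a` to `a⋆`: if it vanishes, then `a a⋆ = 0`. -/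
theorem coeHom_injective :
    Function.Injective (DoubleCentralizer.coeHom : A →⋆ₙₐ[ℂ] DoubleCentralizer ℂ A) := by
  refine (injective_iff_map_eq_zero _).2 fun a ha => ?_
  have h : a * star a = 0 := congrArg (fun T : DoubleCentralizer ℂ A => T.fst (star a)) ha
  exact CStarRing.mul_star_self_eq_zero_iff a |>.1 h

end Strict

/-! ### The implementing unitaries in the multiplier algebra of the stabilization -/

namespace StableAlg

open Filter Topology

variable {R : Type*} [CommRing R]

theorem of_eq_of_mul (k l : R⁰) (x : RingAlg R) :
    of k x = of (l * k) (RingAlg.s l * x * star (RingAlg.s l)) :=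
  (of_conj k l x).symm

/-- The multiplier is the strict limit of `ω_i(s_m)` along divisibility. On a fixed `ω_k(y)` both
products are eventually constant: for `i = l k` because `s_m` commutes with `s_l`, and from the
right for `i = l m k`, where the surplus `s_m⋆` cancels and raises the level to `m k`. -/
theorem exists_dilation (m : R⁰) : ∃ T : DoubleCentralizer ℂ (StableAlg R), ∀ k y,
    T.fst (of k y) = of k (RingAlg.s m * y) ∧ T.snd (of k y) = of (m * k) (RingAlg.s m * y) := by
  have hl : ∀ (k : R⁰) y, Tendsto (fun i : DivIndex R => of i.val (RingAlg.s m) * of k y) atTop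
      (𝓝 (of k (RingAlg.s m * y))) := fun k y => by
    refine tendsto_const_nhds.congr' ?_
    filter_upwards [eventually_ge_atTop (⟨k⟩ : DivIndex R)] with i hi
    obtain ⟨l, hl⟩ := hi
    rw [hl, of_eq_of_mul k l, of_eq_of_mul k l, ← map_mul, ← mul_assoc, ← mul_assoc,
      ← mul_assoc, RingAlg.s_mul_s, RingAlg.s_mul_s, mul_comm l m]
  have hr : ∀ (k : R⁰) y, Tendsto (fun i : DivIndex R => of k y * of i.val (RingAlg.s m)) atTop
      (𝓝 (of (m * k) (RingAlg.s m * y))) := fun k y => by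
    refine tendsto_const_nhds.congr' ?_
    filter_upwards [eventually_ge_atTop (⟨m * k⟩ : DivIndex R)] with i hi
    obtain ⟨l, hl⟩ := hi
    -- The factor `m` of the index is what lets the isometry on the right be absorbed.
    have h1 : star (RingAlg.s (l * m)) * RingAlg.s m = star (RingAlg.s l) := by
      rw [mul_comm, ← RingAlg.s_mul_s, star_mul, mul_assoc, RingAlg.star_s_mul_s, RingAlg.mul_one']
    change i.val = l * (m * k) at hl
    rw [hl, of_eq_of_mul (m * k) l, of_eq_of_mul k (l * m), mul_assoc l, ← map_mul,
      mul_assoc _ (star _), h1, ← RingAlg.s_mul_s]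
    simp only [mul_assoc]
  obtain ⟨T, hT⟩ := exists_multiplier (l := atTop) (a := fun i : DivIndex R => of i.val (RingAlg.s m))
    (C := 1) (fun i => (norm_of _ _).le.trans
      (RingAlg.norm_le_one_of_star_mul_self (RingAlg.star_s_mul_s m))) dense_range_of
    (by rintro _ ⟨k, y, rfl⟩; exact ⟨_, hl k y⟩) (by rintro _ ⟨k, y, rfl⟩; exact ⟨_, hr k y⟩)
  exact ⟨T, fun k y => ⟨tendsto_nhds_unique (hT _).1 (hl k y),
    tendsto_nhds_unique (hT _).2 (hr k y)⟩⟩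

/-- At level `k` translation by `n` is given by `u^{kn}`, since `V_k⋆ u^{kn} V_k = u^n`. The
relation `s_l u^{kn} = u^{lkn} s_l` makes the products with `ω_k(y)` constant for `k ∣ i`. -/
theorem exists_translation (n : R) : ∃ T : DoubleCentralizer ℂ (StableAlg R), ∀ (k : R⁰) y,
    T.fst (of k y) = of k (RingAlg.u (k * n) * y) ∧
      T.snd (of k y) = of k (y * RingAlg.u (k * n)) := by
  have hl : ∀ (k : R⁰) y, Tendsto (fun i : DivIndex R => of i.val (RingAlg.u (i.val * n)) * of k y) atTop
      (𝓝 (of k (RingAlg.u (k * n) * y))) := fun k y => by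
    refine tendsto_const_nhds.congr' ?_
    filter_upwards [eventually_ge_atTop (⟨k⟩ : DivIndex R)] with i hi
    obtain ⟨l, hl⟩ := hi
    rw [hl, of_eq_of_mul k l, of_eq_of_mul k l, ← map_mul, ← mul_assoc, ← mul_assoc,
      ← mul_assoc, RingAlg.s_mul_u, Submonoid.coe_mul, mul_assoc (l : R)]
  have hr : ∀ (k : R⁰) y, Tendsto (fun i : DivIndex R => of k y * of i.val (RingAlg.u (i.val * n))) atTop
      (𝓝 (of k (y * RingAlg.u (k * n)))) := fun k y => by
    refine tendsto_const_nhds.congr' ?_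
    filter_upwards [eventually_ge_atTop (⟨k⟩ : DivIndex R)] with i hi
    obtain ⟨l, hl⟩ := hi
    -- The adjoint of the relation between `s_l` and `u^{-kn}`.
    have h1 : star (RingAlg.s l) * RingAlg.u (l * (k * n)) =
        RingAlg.u (k * n) * star (RingAlg.s l) := by
      have h := congrArg star (RingAlg.s_mul_u l (-(k * n)))
      rw [star_mul, star_mul, mul_neg, RingAlg.star_u, RingAlg.star_u, neg_neg, neg_neg] at h
      exact h.symm
    rw [hl, of_eq_of_mul k l, of_eq_of_mul k l, ← map_mul, Submonoid.coe_mul, mul_assoc (l : R),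
      mul_assoc _ (star _), h1]
    simp only [mul_assoc]
  obtain ⟨T, hT⟩ := exists_multiplier (l := atTop)
    (a := fun i : DivIndex R => of i.val (RingAlg.u (i.val * n)))
    (C := 1) (fun i => (norm_of _ _).le.trans
      (RingAlg.norm_le_one_of_star_mul_self (RingAlg.star_u_mul_u _))) dense_range_of
    (by rintro _ ⟨k, y, rfl⟩; exact ⟨_, hl k y⟩) (by rintro _ ⟨k, y, rfl⟩; exact ⟨_, hr k y⟩)
  exact ⟨T, fun k y => ⟨tendsto_nhds_unique (hT _).1 (hl k y),
    tendsto_nhds_unique (hT _).2 (hr k y)⟩⟩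

/-- The multiplier of `𝔄(R)` which implements the dilation by `m`. -/
def dil (m : R⁰) : DoubleCentralizer ℂ (StableAlg R) := (exists_dilation m).choose

/-- The multiplier of `𝔄(R)` which implements the translation by `n`. -/
def trans (n : R) : DoubleCentralizer ℂ (StableAlg R) := (exists_translation n).choose

theorem dil_fst (m k : R⁰) (y : RingAlg R) : (dil m).fst (of k y) = of k (RingAlg.s m * y) :=
  ((exists_dilation m).choose_spec k y).1

theorem dil_snd (m k : R⁰) (y : RingAlg R) : (dil m).snd (of k y) = of (m * k) (RingAlg.s m * y) :=
  ((exists_dilation m).choose_spec k y).2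

theorem trans_fst (n : R) (k : R⁰) (y : RingAlg R) :
    (trans n).fst (of k y) = of k (RingAlg.u (k * n) * y) :=
  ((exists_translation n).choose_spec k y).1

theorem trans_snd (n : R) (k : R⁰) (y : RingAlg R) :
    (trans n).snd (of k y) = of k (y * RingAlg.u (k * n)) :=
  ((exists_translation n).choose_spec k y).2

theorem star_dil_fst (m k : R⁰) (y : RingAlg R) :
    (star (dil m)).fst (of k y) = of (m * k) (y * star (RingAlg.s m)) := by
  rw [DoubleCentralizer.star_fst, ← map_star (of k), dil_snd, ← map_star, star_mul, star_star]

theorem star_trans_fst (n : R) (k : R⁰) (y : RingAlg R) :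
    (star (trans n)).fst (of k y) = of k (star (RingAlg.u (k * n)) * y) := by
  rw [DoubleCentralizer.star_fst, ← map_star (of k), trans_snd, ← map_star, star_mul, star_star]

theorem ext_of {T T' : DoubleCentralizer ℂ (StableAlg R)}
    (h : ∀ k y, T.fst (of k y) = T'.fst (of k y)) : T = T' :=
  multiplier_ext dense_range_of (by rintro _ ⟨k, y, rfl⟩; exact h k y)

theorem mul_fst_apply (T T' : DoubleCentralizer ℂ (StableAlg R)) (x : StableAlg R) :
    (T * T').fst x = T.fst (T'.fst x) := rfl

/-- Both products send `ω_k(y)` to `ω_{mk}(s_m y s_m⋆)`, which is `ω_k(y)` by the identification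
made in the limit; thus the isometry `s_m` has become unitary. -/
theorem dil_mem_unitary (m : R⁰) : dil m ∈ unitary (DoubleCentralizer ℂ (StableAlg R)) := by
  constructor <;> refine ext_of fun k y => ?_
  · rw [mul_fst_apply, dil_fst, star_dil_fst, ← of_eq_of_mul]
    rfl
  · rw [mul_fst_apply, star_dil_fst, dil_fst, ← mul_assoc, ← of_eq_of_mul]
    rfl

theorem trans_mem_unitary (n : R) : trans n ∈ unitary (DoubleCentralizer ℂ (StableAlg R)) := by
  constructor <;> refine ext_of fun k y => ?_
  · rw [mul_fst_apply, trans_fst, star_trans_fst, ← mul_assoc, RingAlg.star_u_mul_u,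
      RingAlg.one_mul']
    rfl
  · rw [mul_fst_apply, star_trans_fst, trans_fst, ← mul_assoc, RingAlg.u_mul_star_u,
      RingAlg.one_mul']
    rfl

variable (R) in
/-- The unitary multipliers which implement the dilations. -/
def dilHom : R⁰ →* unitary (DoubleCentralizer ℂ (StableAlg R)) where
  toFun m := ⟨dil m, dil_mem_unitary m⟩
  map_one' := Subtype.ext <| ext_of fun k y => by
    rw [dil_fst, RingAlg.s_one, RingAlg.one_mul']; rfl
  map_mul' m n := Subtype.ext <| ext_of fun k y => by
    rw [Submonoid.coe_mul, mul_fst_apply, dil_fst, dil_fst, dil_fst, ← mul_assoc, RingAlg.s_mul_s]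

variable (R) in
/-- The unitary multipliers which implement the translations. -/
def transHom : Multiplicative R →* unitary (DoubleCentralizer ℂ (StableAlg R)) where
  toFun n := ⟨trans n.toAdd, trans_mem_unitary n.toAdd⟩
  map_one' := Subtype.ext <| ext_of fun k y => by
    rw [trans_fst, toAdd_one, mul_zero, RingAlg.u_zero, RingAlg.one_mul']; rfl
  map_mul' m n := Subtype.ext <| ext_of fun k y => by
    rw [Submonoid.coe_mul, mul_fst_apply, trans_fst, trans_fst, trans_fst, ← mul_assoc,
      RingAlg.u_mul_u, toAdd_mul, mul_add]

theorem dilHom_mul_transHom (m : R⁰) (n : R) :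
    dilHom R m * transHom R (Multiplicative.ofAdd n) =
      transHom R (Multiplicative.ofAdd (m * n)) * dilHom R m :=
  Subtype.ext <| ext_of fun k y => by
    change (dil m).fst ((trans n).fst (of k y)) = (trans (m * n)).fst ((dil m).fst (of k y))
    rw [dil_fst, trans_fst, trans_fst, dil_fst, ← mul_assoc, ← mul_assoc, RingAlg.s_mul_u,
      mul_left_comm]

/-- The multiplier `s_k⋆ x s_k` for `x ∈ 𝔄(R)_1` is `x ∈ 𝔄(R)_k`. -/
theorem star_dil_mul_of_mul_dil (k : R⁰) (x : RingAlg R) :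
    star (dil k) * DoubleCentralizer.coeHom (of 1 x) * dil k =
      DoubleCentralizer.coeHom (𝕜 := ℂ) (of k x) := by
  rw [multiplier_mul_coe, star_dil_fst, coe_mul_multiplier, dil_snd, mul_one, ← mul_assoc,
    ← of_eq_of_mul]

/-- At level `k` the projection `ω_1(1)` is `s_k s_k⋆`, so compressing `ω_k(x)` by it gives `ω_k(s_k
(s_k⋆ x s_k) s_k⋆) = ω_1(s_k⋆ x s_k)`. The range is closed because `ω_1` is isometric, so the
general case follows by density. -/
theorem of_one_mul_mul_of_one_mem_range (a : StableAlg R) :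
    of 1 1 * a * of 1 1 ∈ Set.range (of (1 : R⁰)) := by
  have hc : IsClosed (Set.range (of (1 : R⁰))) :=
    (AddMonoidHomClass.isometry_of_norm _
      (norm_of (1 : R⁰))).isClosedEmbedding.isClosed_range
  refine ind (P := fun a => of 1 1 * a * of 1 1 ∈
    Set.range (of (1 : R⁰))) a (hc.preimage (by fun_prop)) fun k x => ?_
  refine ⟨star (RingAlg.s k) * x * RingAlg.s k, ?_⟩
  rw [of_eq_of_mul 1 k, of_eq_of_mul 1 k, mul_one, ← map_mul, ← map_mul,
    RingAlg.mul_one']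
  simp only [mul_assoc]

end StableAlg

/-! ### Generators of the `ax + b`-group of the quotient field -/

section AffineGroup

variable {R : Type*} [CommRing R]

/-! ### Values on fractions with integral numerator and denominator -/

section Val

variable {H : Type*} [Group H] (S : R⁰ →* H) (T : Multiplicative R →* H)

/-- The value at `d⁻¹ (c, r)` of the homomorphism determined by `S` and `T`. -/
def affineVal (d c : R⁰) (r : R) : H := (S d)⁻¹ * (T (.ofAdd r) * S c)

theorem affineVal_mul_left
    (hST : ∀ (m : R⁰) (n : R), S m * T (.ofAdd n) = T (.ofAdd (m * n)) * S m) (l d c : R⁰) (r : R) :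
    affineVal S T (l * d) (l * c) (l * r) = affineVal S T d c r := by
  rw [affineVal, affineVal, map_mul S l c, ← mul_assoc (T _), ← hST, map_mul S l d]
  group

/-- Multiplication of left fractions: the inner denominator `S(d')⁻¹` is moved to the left, past
`S(c)` by commutativity of `R` and past `T(r)` at the price of replacing `r` by `d' r`. -/
theorem affineVal_mul (hST : ∀ (m : R⁰) (n : R), S m * T (.ofAdd n) = T (.ofAdd (m * n)) * S m)
    (d c d' c' : R⁰) (r r' : R) :
    affineVal S T d c r * affineVal S T d' c' r' =
      affineVal S T (d' * d) (c * c') (d' * r + c * r') := by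
  have h : S c * (S d')⁻¹ = (S d')⁻¹ * S c := by
    rw [mul_inv_eq_iff_eq_mul, mul_assoc, ← map_mul, mul_comm, map_mul, inv_mul_cancel_left]
  have h' : T (.ofAdd r) * (S d')⁻¹ = (S d')⁻¹ * T (.ofAdd (d' * r)) := by
    rw [mul_inv_eq_iff_eq_mul, mul_assoc, ← hST, inv_mul_cancel_left]
  simp only [affineVal, map_mul, ofAdd_add, mul_inv_rev]
  calc (S d)⁻¹ * (T (.ofAdd r) * S c) * ((S d')⁻¹ * (T (.ofAdd r') * S c'))
      = (S d)⁻¹ * (T (.ofAdd r) * (S c * (S d')⁻¹)) * (T (.ofAdd r') * S c') := by group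
    _ = (S d)⁻¹ * ((T (.ofAdd r) * (S d')⁻¹) * S c) * (T (.ofAdd r') * S c') := by
      rw [h, mul_assoc (T _)]
    _ = (S d)⁻¹ * (S d')⁻¹ * T (.ofAdd (d' * r)) * (S c * T (.ofAdd r')) * S c' := by
      rw [h']; group
    _ = _ := by rw [hST]; group

end Val

variable [IsDomain R]

theorem dilationBy_mul (m n : R⁰) : dilationBy (m * n) = dilationBy m * dilationBy n := by
  rw [AffineGroup.mul_def]
  ext <;> simp [dilationBy]

theorem dilationBy_one : dilationBy (1 : R⁰) = 1 := by
  rw [AffineGroup.one_def]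
  ext <;> simp [dilationBy]

theorem translationBy_add (m n : R) :
    translationBy (m + n) = translationBy m * translationBy n := by
  rw [AffineGroup.mul_def]
  ext <;> simp [translationBy, add_comm]

theorem translationBy_zero : translationBy (0 : R) = 1 := by
  rw [AffineGroup.one_def]
  ext <;> simp [translationBy]

theorem translationBy_neg (n : R) : translationBy (-n) = (translationBy n)⁻¹ := by
  rw [eq_inv_iff_mul_eq_one, ← translationBy_add, neg_add_cancel, translationBy_zero]

theorem dilationBy_mul_translationBy (m : R⁰) (n : R) :
    dilationBy m * translationBy n = translationBy (m * n) * dilationBy m := by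
  rw [AffineGroup.mul_def, AffineGroup.mul_def]
  ext <;> simp [translationBy, dilationBy]

/-- The matrix with rows `(m, n)` and `(0, 1)`. -/
def affineBy (m : R⁰) (n : R) : AffineGroup (FractionRing R) := translationBy n * dilationBy m

theorem affineBy_mul (m m' : R⁰) (n n' : R) :
    affineBy m n * affineBy m' n' = affineBy (m * m') (n + m * n') := by
  rw [affineBy, affineBy, affineBy, translationBy_add, dilationBy_mul, mul_assoc, mul_assoc,
    ← mul_assoc (dilationBy m), dilationBy_mul_translationBy, mul_assoc]

theorem affineBy_zero (m : R⁰) : affineBy m (0 : R) = dilationBy m := by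
  rw [affineBy, translationBy_zero, one_mul]

theorem affineBy_one (n : R) : affineBy 1 n = translationBy n := by
  rw [affineBy, dilationBy_one, mul_one]

theorem affineBy_injective {m m' : R⁰} {n n' : R} (h : affineBy m n = affineBy m' n') :
    m = m' ∧ n = n' := by
  have ha := congrArg (fun g => (g.a : FractionRing R)) h
  have hb := congrArg AffineGroup.b h
  simp only [affineBy, AffineGroup.mul_def, translationBy, dilationBy, one_mul, mul_zero, zero_add,
    IsUnit.unit_spec] at ha hb
  exact ⟨Subtype.ext (IsFractionRing.injective R (FractionRing R) ha),
    IsFractionRing.injective R (FractionRing R) hb⟩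

/-- The `ax + b`-group of the quotient field is the group of left fractions of the integral
matrices: clear the denominators of both entries. -/
theorem exists_eq_inv_mul_affineBy (g : AffineGroup (FractionRing R)) :
    ∃ (d c : R⁰) (r : R), g = (dilationBy d)⁻¹ * affineBy c r := by
  obtain ⟨⟨x, d₁⟩, h₁⟩ := IsLocalization.surj R⁰ (g.a : FractionRing R)
  obtain ⟨⟨y, d₂⟩, h₂⟩ := IsLocalization.surj R⁰ g.b
  have hx : x ≠ 0 := by
    rintro rfl
    simp only [map_zero, mul_eq_zero, Units.ne_zero, false_or] at h₁
    exact nonZeroDivisors.ne_zero d₁.2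
      (IsFractionRing.injective R (FractionRing R) (h₁.trans (map_zero _).symm))
  -- With `a = x / d₁` and `b = y / d₂`, the common denominator is `d₁ d₂` and the numerators are `x
  -- d₂` and `y d₁`.
  refine ⟨d₁ * d₂, ⟨x, mem_nonZeroDivisors_of_ne_zero hx⟩ * d₂, y * d₁, ?_⟩
  rw [eq_inv_mul_iff_mul_eq, affineBy, AffineGroup.mul_def, AffineGroup.mul_def]
  ext
  · simp only [translationBy, dilationBy, Units.val_mul, IsUnit.unit_spec, Submonoid.coe_mul,
      map_mul, one_mul, ← h₁]
    ring
  · simp only [translationBy, dilationBy, IsUnit.unit_spec, Submonoid.coe_mul, map_mul, ← h₂, Units.val_one, mul_zero, zero_add, add_zero]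
    ring

/-! ### Extension of homomorphisms to the group of fractions -/

section Lift

variable {H : Type*} [Group H] (S : R⁰ →* H) (T : Multiplicative R →* H)
  (hST : ∀ (m : R⁰) (n : R), S m * T (.ofAdd n) = T (.ofAdd (m * n)) * S m)

theorem inv_mul_affineBy_mul_left (l d c : R⁰) (r : R) :
    (dilationBy (l * d))⁻¹ * affineBy (l * c) (l * r) = (dilationBy d)⁻¹ * affineBy c r := by
  rw [← zero_add ((l : R) * r), ← affineBy_mul, affineBy_zero, dilationBy_mul, mul_inv_rev,
    mul_assoc, inv_mul_cancel_left]

/-- After expansion to the common denominator `d d'`, equal fractions have equal integral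
numerators, and expansion does not change the value. -/
theorem affineVal_congr (hST : ∀ (m : R⁰) (n : R), S m * T (.ofAdd n) = T (.ofAdd (m * n)) * S m)
    {d c d' c' : R⁰} {r r' : R}
    (h : (dilationBy d)⁻¹ * affineBy c r = (dilationBy d')⁻¹ * affineBy c' r') :
    affineVal S T d c r = affineVal S T d' c' r' := by
  rw [← inv_mul_affineBy_mul_left d', ← inv_mul_affineBy_mul_left d d', mul_comm d' d,
    mul_right_inj] at h
  obtain ⟨h₁, h₂⟩ := affineBy_injective h
  rw [← affineVal_mul_left S T hST d', ← affineVal_mul_left S T hST d d', mul_comm d' d, h₁, h₂]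

/-- A homomorphism on the `ax + b`-group of the quotient field is determined by its values at the
integral dilations and translations. -/
def affineLift : AffineGroup (FractionRing R) →* H :=
  let F : AffineGroup (FractionRing R) → H := fun g =>
    affineVal S T (exists_eq_inv_mul_affineBy g).choose
      (exists_eq_inv_mul_affineBy g).choose_spec.choose
      (exists_eq_inv_mul_affineBy g).choose_spec.choose_spec.choose
  have hF : ∀ d c r, F ((dilationBy d)⁻¹ * affineBy c r) = affineVal S T d c r := fun d c r =>
    affineVal_congr S T hST (exists_eq_inv_mul_affineBy
      ((dilationBy d)⁻¹ * affineBy c r)).choose_spec.choose_spec.choose_spec.symm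
  MonoidHom.mk' F fun g g' => by
    obtain ⟨d, c, r, rfl⟩ := exists_eq_inv_mul_affineBy g
    obtain ⟨d', c', r', rfl⟩ := exists_eq_inv_mul_affineBy g'
    have h : (dilationBy d)⁻¹ * affineBy c r * ((dilationBy d')⁻¹ * affineBy c' r') =
        (dilationBy (d' * d))⁻¹ * affineBy (c * c') (d' * r + c * r') := by
      have h1 : affineBy c r * (dilationBy d')⁻¹ = (dilationBy d')⁻¹ * affineBy c (d' * r) := by
        rw [mul_inv_eq_iff_eq_mul, mul_assoc, eq_inv_mul_iff_mul_eq, ← affineBy_zero, affineBy_mul,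
          affineBy_mul, zero_add, mul_zero, add_zero, mul_comm]
      rw [← affineBy_mul, dilationBy_mul, mul_inv_rev, mul_assoc, ← mul_assoc (affineBy c r), h1]
      simp only [mul_assoc]
    rw [h, hF, hF, hF, affineVal_mul S T hST]

theorem affineLift_inv_mul_affineBy (d c : R⁰) (r : R) :
    affineLift S T hST ((dilationBy d)⁻¹ * affineBy c r) = affineVal S T d c r :=
  affineVal_congr S T hST (exists_eq_inv_mul_affineBy
    ((dilationBy d)⁻¹ * affineBy c r)).choose_spec.choose_spec.choose_spec.symm

theorem affineLift_translationBy (n : R) :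
    affineLift S T hST (translationBy n) = T (.ofAdd n) := by
  have h := affineLift_inv_mul_affineBy S T hST 1 1 n
  rwa [affineVal, map_one, inv_one, one_mul, mul_one, dilationBy_one, inv_one, one_mul,
    affineBy_one] at h

theorem affineLift_dilationBy (m : R⁰) : affineLift S T hST (dilationBy m) = S m := by
  have h := affineLift_inv_mul_affineBy S T hST 1 m 0
  rwa [affineVal, map_one, inv_one, one_mul, ofAdd_zero, map_one, one_mul, dilationBy_one, inv_one,
    one_mul, affineBy_zero] at h

end Lift

end AffineGroup

/-! ### Locally constant functions on the finite adele space -/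

section Adele

variable {R : Type*} [CommRing R]

theorem Hat.comp_algebraMap (r : R) (m : R⁰) :
    (algebraMap R (Hat R) r).comp m = Ideal.Quotient.mk _ r := rfl

theorem Adele.exists_eq_ι (x : Adele R) : ∃ k y, x = Adele.ι k y :=
  LocalizedModule.induction_on (β := fun x => ∃ k y, x = Adele.ι k y) (fun y k => ⟨k, y, rfl⟩) x

theorem Adele.ι_smul (l k : R⁰) (y : Hat R) : ι (l * k) ((l : R) • y) = ι k y :=
  LocalizedModule.mk_cancel_common_left l k y

theorem Adele.ι_injective (k : R⁰) : Function.Injective (ι k : Hat R → Adele R) := by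
  intro x y h
  obtain ⟨u, hu⟩ := LocalizedModule.mk_eq.1 h
  exact Hat.smul_cancel k (Hat.smul_cancel u hu)

theorem Hat.comp_eq_of_dvd {m n : R⁰} (h : m ∣ n) {x y : Hat R} (hxy : x.comp n = y.comp n) :
    x.comp m = y.comp m := by
  obtain ⟨l, rfl⟩ := h
  rw [mul_comm] at hxy
  rw [← comp_compat x l m, ← comp_compat y l m, hxy]

theorem Hat.isOpen_comp_eq (m : R⁰) (x : Hat R) : IsOpen {y : Hat R | y.comp m = x.comp m} := by
  let _ : TopologicalSpace (R ⧸ Ideal.span {(m : R)}) := ⊥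
  have : DiscreteTopology (R ⧸ Ideal.span {(m : R)}) := ⟨rfl⟩
  exact (isOpen_discrete {x.comp m}).preimage (continuous_comp m)

/-- A basic neighbourhood in the product restricts finitely many components; the component modulo
the product of these moduli determines all of them. -/
theorem Hat.exists_comp_eq_subset {U : Set (Hat R)} (hU : IsOpen U) {x : Hat R} (hx : x ∈ U) :
    ∃ m : R⁰, ∀ y : Hat R, y.comp m = x.comp m → y ∈ U := by
  let _ : ∀ m : R⁰, TopologicalSpace (R ⧸ Ideal.span {(m : R)}) := fun _ => ⊥
  obtain ⟨V, hV, rfl⟩ := isOpen_induced_iff.1 hU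
  obtain ⟨I, u, hu, hI⟩ := isOpen_pi_iff.1 hV _ hx
  refine ⟨∏ i ∈ I, i, fun y hy => hI fun i hi => ?_⟩
  rw [comp_eq_of_dvd (Finset.dvd_prod_of_mem (fun i => i) hi) hy]
  exact (hu i hi).2

theorem zeroAtInfty_sum_apply {X ι : Type*} [TopologicalSpace X] (t : Finset ι) (f : ι → C₀(X, ℂ))
    (x : X) : (∑ i ∈ t, f i) x = ∑ i ∈ t, f i x :=
  map_sum (⟨⟨fun f => f x, rfl⟩, fun _ _ => rfl⟩ : C₀(X, ℂ) →+ ℂ) f t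

section Finite

variable [∀ m : R⁰, Finite (R ⧸ Ideal.span {(m : R)})]

/-- A continuous function on `R̂` is almost constant on the cosets of `m R̂` for some `m`. -/
theorem Hat.exists_comp_eq_imp_dist_lt {f : Hat R → ℂ} (hf : Continuous f) {ε : ℝ} (hε : 0 < ε) :
    ∃ m : R⁰, ∀ x y : Hat R, x.comp m = y.comp m → dist (f x) (f y) < ε := by
  have h : ∀ x : Hat R, ∃ m : R⁰, ∀ y : Hat R, y.comp m = x.comp m → dist (f y) (f x) < ε / 2 :=
    fun x => exists_comp_eq_subset (Metric.isOpen_ball.preimage hf)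
      (Metric.mem_ball_self (half_pos hε))
  choose m hm using h
  obtain ⟨t, ht⟩ := isCompact_univ.elim_finite_subcover
    (fun x : Hat R => {y : Hat R | y.comp (m x) = x.comp (m x)}) (fun x => isOpen_comp_eq _ x)
    fun x _ => Set.mem_iUnion.2 ⟨x, rfl⟩
  -- A modulus divisible by those of the finite subcover: then `x` and `y` lie in one member of it,
  -- and each value is within `ε / 2` of the value at its centre.
  refine ⟨∏ x ∈ t, m x, fun x y hxy => ?_⟩
  obtain ⟨z, hz, hxz⟩ := Set.mem_iUnion₂.1 (ht (Set.mem_univ x))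
  have h1 := comp_eq_of_dvd (Finset.dvd_prod_of_mem m hz) hxy
  refine (dist_triangle_right _ _ (f z)).trans_lt ?_
  linarith [hm z x hxz, hm z y (h1.symm.trans hxz)]

open Classical in
theorem pHat_apply (x : Adele R) : Adele.pHat R x = if x ∈ Adele.hat R then 1 else 0 := rfl

theorem star_pHat : star (Adele.pHat R) = Adele.pHat R := by
  ext x
  change star (Adele.pHat R x) = Adele.pHat R x
  rw [pHat_apply]
  split_ifs <;> simp

theorem pHat_mul_pHat : Adele.pHat R * Adele.pHat R = Adele.pHat R := by
  ext x
  change Adele.pHat R x * Adele.pHat R x = Adele.pHat R x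
  rw [pHat_apply]
  split_ifs <;> simp

theorem pHat_ne_zero : Adele.pHat R ≠ 0 := fun h => by
  have h1 := congrArg (fun f : C₀(Adele R, ℂ) => f (Adele.ι 1 0)) h
  simp only [pHat_apply] at h1
  rw [if_pos ⟨0, rfl⟩] at h1
  exact one_ne_zero h1

end Finite

variable [IsDomain R]

theorem dilationBy_smul_ι (m k : R⁰) (y : Hat R) :
    dilationBy m • Adele.ι k y = Adele.ι k ((m : R) • y) := by
  rw [Adele.smul_def]
  change algebraMap R (FractionRing R) m • Adele.ι k y + (0 : FractionRing R) • (1 : Adele R) = _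
  rw [zero_smul, add_zero]
  change algebraMap R (Localization R⁰) m • LocalizedModule.mk y k = LocalizedModule.mk (_ • y) k
  rw [← Localization.mk_one_eq_algebraMap, LocalizedModule.mk_smul_mk, one_mul]

theorem dilationBy_smul_ι_self (k : R⁰) (y : Hat R) :
    dilationBy k • Adele.ι k y = Adele.ι 1 y := by
  have h := Adele.ι_smul k 1 y
  rw [mul_one] at h
  rw [dilationBy_smul_ι, h]

theorem translationBy_smul_ι_one (n : R) (y : Hat R) :
    translationBy n • Adele.ι 1 y = Adele.ι 1 (y + algebraMap R (Hat R) n) := by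
  rw [Adele.smul_def]
  change ((1 : (FractionRing R)ˣ) : FractionRing R) • Adele.ι 1 y +
    algebraMap R (FractionRing R) n • (1 : Adele R) = _
  rw [Units.val_one, one_smul]
  have h1 : (1 : Adele R) = LocalizedModule.mk 1 1 := OreLocalization.one_def
  change _ + algebraMap R (Localization R⁰) n • _ = _
  rw [h1, ← Localization.mk_one_eq_algebraMap]
  have h2 : Localization.mk n (1 : R⁰) • LocalizedModule.mk (1 : Hat R) (1 : R⁰) =
    LocalizedModule.mk (n • 1) (1 * 1) := LocalizedModule.mk_smul_mk ..
  refine (congrArg (Adele.ι 1 y + ·) h2).trans ?_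
  refine LocalizedModule.mk_add_mk.trans ?_
  rw [one_smul, one_mul, one_mul, one_smul, Algebra.algebraMap_eq_smul_one]
  rfl

theorem affineBy_smul_ι_one (m : R⁰) (n : R) (y : Hat R) :
    affineBy m n • Adele.ι 1 y = Adele.ι 1 ((m : R) • y + algebraMap R (Hat R) n) := by
  rw [affineBy, mul_smul, dilationBy_smul_ι, translationBy_smul_ι_one]

theorem affineBy_smul_mem_hat (m : R⁰) (n : R) {x : Adele R} (hx : x ∈ Adele.hat R) :
    affineBy m n • x ∈ Adele.hat R := by
  obtain ⟨y, rfl⟩ := hx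
  exact ⟨_, (affineBy_smul_ι_one m n y).symm⟩

theorem mem_hat_of_affineBy_inv_smul (m : R⁰) (n : R) {x : Adele R}
    (hx : (affineBy m n)⁻¹ • x ∈ Adele.hat R) : x ∈ Adele.hat R := by
  simpa using affineBy_smul_mem_hat m n hx

/-- The image of `R̂` under `(m, n)` is `n + m R̂`, and `m R̂` is the kernel of the projection to
`R/(m)`. -/
theorem affineBy_inv_smul_ι_mem_hat (m : R⁰) (n : R) (y : Hat R) :
    (affineBy m n)⁻¹ • Adele.ι 1 y ∈ Adele.hat R ↔ y.comp m = Ideal.Quotient.mk _ n := by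
  have h1 : y.comp m = Ideal.Quotient.mk _ n ↔ (y - algebraMap R (Hat R) n).comp m = 0 := by
    rw [← sub_eq_zero]; rfl
  rw [h1, Hat.comp_eq_zero_iff]
  constructor
  · rintro ⟨z, hz⟩
    refine ⟨z, ?_⟩
    rw [eq_inv_smul_iff, affineBy_smul_ι_one] at hz
    rw [← Adele.ι_injective 1 hz, add_sub_cancel_right]
    rfl
  · rintro ⟨z, hz⟩
    refine ⟨z, ?_⟩
    rw [eq_inv_smul_iff, affineBy_smul_ι_one]
    rw [sub_eq_iff_eq_add] at hz
    rw [hz]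
    rfl

theorem Adele.mem_range_ι {k : R⁰} {x : Adele R} :
    x ∈ Set.range (ι k) ↔ dilationBy k • x ∈ hat R := by
  constructor
  · rintro ⟨y, rfl⟩
    exact ⟨y, (dilationBy_smul_ι_self k y).symm⟩
  · rintro ⟨y, hy⟩
    refine ⟨y, smul_left_cancel (dilationBy k) ?_⟩
    rw [dilationBy_smul_ι_self, hy]

theorem Adele.isOpen_range_ι (k : R⁰) : IsOpen (Set.range (ι k : Hat R → Adele R)) := by
  have h : Set.range (ι k : Hat R → Adele R) = (fun x => dilationBy k • x) ⁻¹' hat R :=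
    Set.ext fun x => mem_range_ι
  rw [h]
  exact isClopen_hat.isOpen.preimage (continuous_const_smul _)

/-- The sets `k⁻¹ R̂` form an open cover of `𝓡`, directed by divisibility, so a compact set lies in
one of them. -/
theorem Adele.exists_subset_range_ι {K : Set (Adele R)} (hK : IsCompact K) :
    ∃ k : R⁰, K ⊆ Set.range (ι k) := by
  refine hK.elim_directed_cover _ isOpen_range_ι (fun x _ => ?_) fun k l => ⟨l * k, ?_, ?_⟩
  · obtain ⟨k, y, rfl⟩ := exists_eq_ι x
    exact Set.mem_iUnion.2 ⟨k, y, rfl⟩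
  · rintro _ ⟨y, rfl⟩
    exact ⟨_, ι_smul l k y⟩
  · rintro _ ⟨y, rfl⟩
    rw [mul_comm]
    exact ⟨_, ι_smul k l y⟩

/-- The translation action on `C₀(𝓡)`. -/
abbrev act : AffineGroup (FractionRing R) →* (C₀(Adele R, ℂ) ≃⋆ₐ[ℂ] C₀(Adele R, ℂ)) :=
  translation (AffineGroup (FractionRing R)) (Adele R)

theorem act_apply (g : AffineGroup (FractionRing R)) (f : C₀(Adele R, ℂ)) (x : Adele R) :
    act g f x = f (g⁻¹ • x) := rfl

theorem act_inv_act (g : AffineGroup (FractionRing R)) (f : C₀(Adele R, ℂ)) :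
    act g⁻¹ (act g f) = f := by
  rw [← StarAlgEquiv.mul_apply, ← map_mul, inv_mul_cancel, map_one, StarAlgEquiv.one_apply]

variable [∀ m : R⁰, Finite (R ⧸ Ideal.span {(m : R)})]

/-- Integral affine maps send `R̂` into itself. -/
theorem pHat_mul_act_affineBy (m : R⁰) (n : R) :
    Adele.pHat R * act (affineBy m n) (Adele.pHat R) = act (affineBy m n) (Adele.pHat R) := by
  ext x
  change Adele.pHat R x * Adele.pHat R ((affineBy m n)⁻¹ • x) = Adele.pHat R ((affineBy m n)⁻¹ • x)
  rw [pHat_apply, pHat_apply]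
  by_cases h : (affineBy m n)⁻¹ • x ∈ Adele.hat R
  · rw [if_pos (mem_hat_of_affineBy_inv_smul m n h), one_mul]
  · rw [if_neg h, mul_zero]

theorem act_translationBy_pHat (n : R) :
    act (translationBy n) (Adele.pHat R) = Adele.pHat R := by
  classical
  ext x
  rw [act_apply, pHat_apply, pHat_apply]
  refine if_congr ⟨fun h => ?_, fun h => ?_⟩ rfl rfl
  · rw [← affineBy_one] at h
    exact mem_hat_of_affineBy_inv_smul 1 n h
  · rw [← translationBy_neg, ← affineBy_one]
    exact affineBy_smul_mem_hat 1 (-n) h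

/-- Each point of `R̂` lies in exactly one coset `q + m R̂`. This is the source of the sum relation
in the crossed product. -/
theorem sum_act_affineBy_pHat (m : R⁰) [Fintype (R ⧸ Ideal.span {(m : R)})] :
    ∑ q : R ⧸ Ideal.span {(m : R)}, act (affineBy m q.out) (Adele.pHat R) = Adele.pHat R := by
  classical
  ext x
  rw [zeroAtInfty_sum_apply]
  simp only [act_apply, pHat_apply]
  by_cases hx : x ∈ Adele.hat R
  · rw [if_pos hx]
    obtain ⟨y, rfl⟩ := hx
    simp only [affineBy_inv_smul_ι_mem_hat, Ideal.Quotient.mk_out]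
    simp
  · rw [if_neg hx]
    exact Finset.sum_eq_zero fun q _ => if_neg fun h => hx (mem_hat_of_affineBy_inv_smul m _ h)

/-- Linear combinations of the characteristic functions of the sets `k⁻¹(n + m R̂)` are dense. -/
theorem exists_step_approx (f : C₀(Adele R, ℂ)) {ε : ℝ} (hε : 0 < ε) :
    ∃ (k m : R⁰) (c : R ⧸ Ideal.span {(m : R)} → ℂ), ‖f - ∑ᶠ q : R ⧸ Ideal.span {(m : R)},
      c q • act ((dilationBy k)⁻¹ * affineBy m q.out) (Adele.pHat R)‖ ≤ ε := by
  classical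
  obtain ⟨K, hK, hKε⟩ := Filter.mem_cocompact.1
    (f.zero_at_infty' (Metric.ball_mem_nhds (0 : ℂ) hε))
  obtain ⟨k, hk⟩ := Adele.exists_subset_range_ι hK
  obtain ⟨m, hm⟩ := Hat.exists_comp_eq_imp_dist_lt
    (f.continuous_toFun.comp (Adele.continuous_ι k)) hε
  -- `k` is chosen so that `f` is small off `k⁻¹ R̂`, and `m` so that `f` nearly has constant values
  -- on the pieces `k⁻¹(q + m R̂)`; the coefficient is the value at the point `k⁻¹ q`.
  refine ⟨k, m, fun q => f (Adele.ι k (algebraMap R (Hat R) q.out)), ?_⟩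
  have := Fintype.ofFinite (R ⧸ Ideal.span {(m : R)})
  rw [finsum_eq_sum_of_fintype, ← ZeroAtInftyContinuousMap.norm_toBCF_eq_norm]
  refine (BoundedContinuousFunction.norm_le hε.le).2 fun x => ?_
  change ‖f x - (∑ q : R ⧸ Ideal.span {(m : R)}, f (Adele.ι k (algebraMap R (Hat R) q.out)) •
    act ((dilationBy k)⁻¹ * affineBy m q.out) (Adele.pHat R)) x‖ ≤ ε
  rw [zeroAtInfty_sum_apply]
  simp only [ZeroAtInftyContinuousMap.smul_apply, act_apply, mul_inv_rev, inv_inv, mul_smul,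
    pHat_apply]
  by_cases hx : x ∈ Set.range (Adele.ι k)
  · obtain ⟨y, rfl⟩ := hx
    simp only [dilationBy_smul_ι_self, affineBy_inv_smul_ι_mem_hat, Ideal.Quotient.mk_out]
    simp only [smul_eq_mul, mul_ite, mul_one, mul_zero, Finset.sum_ite_eq, Finset.mem_univ, if_true]
    rw [← dist_eq_norm]
    refine (hm _ _ ?_).le
    rw [Hat.comp_algebraMap, Ideal.Quotient.mk_out]
  · rw [Finset.sum_eq_zero, sub_zero]
    · have h := hKε (fun h => hx (hk h) : x ∈ Kᶜ)
      exact (mem_ball_zero_iff.1 h).le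
    · intro q _
      rw [if_neg, smul_zero]
      exact fun h => hx (Adele.mem_range_ι.2 (mem_hat_of_affineBy_inv_smul m _ h))

end Adele

/-! ### Orthogonal projections -/

section Projections

variable {C ι : Type*} [NonUnitalCStarAlgebra C]

/-- Positive elements with sum zero all vanish; the C⋆-identity then gives `x i = 0`. -/
theorem eq_zero_of_sum_star_mul_self_eq_zero {t : Finset ι} {x : ι → C}
    (h : ∑ i ∈ t, star (x i) * x i = 0) : ∀ i ∈ t, x i = 0 := by
  let _ := CStarAlgebra.spectralOrder C
  have _ := CStarAlgebra.spectralOrderedRing C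
  intro i hi
  have h1 := (Finset.sum_eq_zero_iff_of_nonneg fun i _ => star_mul_self_nonneg (x i)).1 h i hi
  exact (CStarRing.star_mul_self_eq_zero_iff _).1 h1

variable [Fintype ι] {p : ι → C}

/-- Projections which add up to a projection are orthogonal. -/
theorem mul_eq_zero_of_sum_eq {e : C} (hs : ∀ i, star (p i) = p i) (hp : ∀ i, p i * p i = p i)
    (he : e * e = e) (hsum : ∑ i, p i = e) {i j : ι} (hij : i ≠ j) : p i * p j = 0 := by
  classical
  have hes : star e = e := by rw [← hsum, star_sum]; exact Finset.sum_congr rfl fun i _ => hs i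
  -- Each `p i` lies under `e`: the elements `(p i e - p i)⋆ (p i e - p i)` add up to `eee - ee -
  -- (ee - e) = 0`.
  have h1 : ∀ i, p i * e = p i := fun i => by
    have h := eq_zero_of_sum_star_mul_self_eq_zero (t := Finset.univ)
      (x := fun i => p i * e - p i) (by
        have : ∀ i, star (p i * e - p i) * (p i * e - p i) =
            e * p i * e - e * p i - (p i * e - p i) := fun i => by
          rw [star_sub, star_mul, hs, hes, sub_mul, mul_sub, mul_sub, ← mul_assoc, mul_assoc e,
            hp, ← mul_assoc, hp]
        simp only [this, Finset.sum_sub_distrib, ← Finset.mul_sum, ← Finset.sum_mul, hsum, he,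
          sub_self])
    exact sub_eq_zero.1 (h i (Finset.mem_univ i))
  -- The elements `p j p i p j` add up to `p j e p j = p j`, which is already the term `i = j`.
  have h2 : ∑ i ∈ Finset.univ.erase j, star (p i * p j) * (p i * p j) = 0 := by
    have h3 : ∀ i, star (p i * p j) * (p i * p j) = p j * p i * p j := fun i => by
      rw [star_mul, hs, hs, ← mul_assoc, mul_assoc (p j), hp]
    have h4 := Finset.add_sum_erase Finset.univ (fun i => p j * p i * p j) (Finset.mem_univ j)
    simp only [← Finset.mul_sum, ← Finset.sum_mul, hsum, h1, hp] at h4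
    simp only [h3]
    rw [← Finset.sum_mul, ← Finset.mul_sum]
    simpa using h4
  exact eq_zero_of_sum_star_mul_self_eq_zero h2 i (Finset.mem_erase.2 ⟨hij, Finset.mem_univ i⟩)

/-- The representation of `ℂ^ι` defined by a family of orthogonal projections. -/
def projHom (hs : ∀ i, star (p i) = p i) (hp : ∀ i, p i * p i = p i)
    (ho : ∀ i j, i ≠ j → p i * p j = 0) : (ι → ℂ) →⋆ₙₐ[ℂ] C where
  toFun c := ∑ i, c i • p i
  map_smul' a c := by
    simp only [Pi.smul_apply, smul_assoc, Finset.smul_sum]; rfl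
  map_zero' := by simp
  map_add' c d := by simp only [Pi.add_apply, add_smul, Finset.sum_add_distrib]
  map_mul' c d := by
    rw [Finset.sum_mul]
    refine Finset.sum_congr rfl fun i _ => ?_
    rw [Finset.mul_sum, Finset.sum_eq_single i]
    · rw [smul_mul_smul_comm, hp, Pi.mul_apply]
    · intro j _ hj
      rw [smul_mul_smul_comm, ho i j hj.symm, smul_zero]
    · simp
  map_star' c := by
    rw [star_sum]
    exact Finset.sum_congr rfl fun i _ => by rw [star_smul, hs, Pi.star_apply]

theorem projHom_apply (hs : ∀ i, star (p i) = p i) (hp : ∀ i, p i * p i = p i)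
    (ho : ∀ i j, i ≠ j → p i * p j = 0) (c : ι → ℂ) : projHom hs hp ho c = ∑ i, c i • p i := rfl

/-- Orthogonality lets the coefficients be recovered; this detects injectivity once the projections
are nonzero. -/
theorem projHom_mul (hs : ∀ i, star (p i) = p i) (hp : ∀ i, p i * p i = p i)
    (ho : ∀ i j, i ≠ j → p i * p j = 0) (c : ι → ℂ) (i : ι) :
    projHom hs hp ho c * p i = c i • p i := by
  rw [projHom_apply, Finset.sum_mul, Finset.sum_eq_single i]
  · rw [smul_mul_assoc, hp]
  · intro j _ hj
    rw [smul_mul_assoc, ho j i hj, smul_zero]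
  · simp

end Projections

/-! ### Covariant representations -/

section Covariant

variable (R : Type*) [CommRing R] [IsDomain R] (M : Type*) [CStarAlgebra M]

/-- A unitary representation of the `ax + b`-group and a projection `e` which is the sum of its
translates under `x ↦ m x + q`, for `q` in a set of representatives of `R/(m)`. -/
structure AffineRep where
  U : AffineGroup (FractionRing R) →* unitary M
  e : M
  star_e : star e = e
  e_mul_e : e * e = e
  translation : ∀ n : R, (U (translationBy n) : M) * e * star (U (translationBy n) : M) = e
  sum_eq : ∀ m : R⁰, ∑ᶠ q : R ⧸ Ideal.span {(m : R)},
    (U (affineBy m q.out) : M) * e * star (U (affineBy m q.out) : M) = e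

variable {R M}

namespace AffineRep

variable (ρ : AffineRep R M)

/-- The action of the `ax + b`-group on `C₀(𝓡) × M`. -/
def pairAct (g : AffineGroup (FractionRing R)) :
    C₀(Adele R, ℂ) × M →⋆ₙₐ[ℂ] C₀(Adele R, ℂ) × M where
  toFun x := (act g x.1, ρ.U g * x.2 * star (ρ.U g : M))
  map_smul' c x := by
    simp only [Prod.smul_fst, Prod.smul_snd, map_smul, mul_smul_comm, smul_mul_assoc]
    rfl
  map_zero' := by simp
  map_add' x y := by simp [mul_add, add_mul]
  map_mul' x y := by
    refine Prod.ext (map_mul _ _ _) ?_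
    simp only [Prod.snd_mul, mul_assoc]
    rw [← mul_assoc (star (ρ.U g : M)) (ρ.U g : M), Unitary.coe_star_mul_self, one_mul]
  map_star' x := by
    refine Prod.ext (map_star _ _) ?_
    simp [mul_assoc]

theorem pairAct_mul (g h : AffineGroup (FractionRing R)) (x : C₀(Adele R, ℂ) × M) :
    ρ.pairAct (g * h) x = ρ.pairAct g (ρ.pairAct h x) := by
  refine Prod.ext ?_ ?_
  · change act (g * h) x.1 = act g (act h x.1)
    rw [map_mul]
    rfl
  · change (ρ.U (g * h) : M) * x.2 * star (ρ.U (g * h) : M) =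
      ρ.U g * (ρ.U h * x.2 * star (ρ.U h : M)) * star (ρ.U g : M)
    rw [map_mul, Submonoid.coe_mul, star_mul]
    simp only [mul_assoc]

variable [∀ m : R⁰, Finite (R ⧸ Ideal.span {(m : R)})]

/-- The translates of `(p_{R̂}, e)`. -/
def pair (g : AffineGroup (FractionRing R)) : C₀(Adele R, ℂ) × M :=
  ρ.pairAct g (Adele.pHat R, ρ.e)

theorem pair_mul (g h : AffineGroup (FractionRing R)) : ρ.pair (g * h) = ρ.pairAct g (ρ.pair h) :=
  ρ.pairAct_mul g h _

theorem pair_one : ρ.pair 1 = (Adele.pHat R, ρ.e) := by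
  refine Prod.ext ?_ ?_
  · change act 1 (Adele.pHat R) = Adele.pHat R
    rw [map_one]
    rfl
  · change (ρ.U 1 : M) * ρ.e * star (ρ.U 1 : M) = ρ.e
    rw [map_one, OneMemClass.coe_one, star_one, one_mul, mul_one]

theorem star_pair (g : AffineGroup (FractionRing R)) : star (ρ.pair g) = ρ.pair g := by
  rw [pair, ← map_star]
  exact congrArg _ (Prod.ext star_pHat ρ.star_e)

theorem pair_mul_pair (g : AffineGroup (FractionRing R)) : ρ.pair g * ρ.pair g = ρ.pair g := by
  rw [pair, ← map_mul]
  exact congrArg _ (Prod.ext pHat_mul_pHat ρ.e_mul_e)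

theorem pair_mul_translationBy (g : AffineGroup (FractionRing R)) (n : R) :
    ρ.pair (g * translationBy n) = ρ.pair g := by
  rw [pair_mul, pair]
  exact congrArg _ (Prod.ext (act_translationBy_pHat n) (ρ.translation n))

theorem sum_pair (g : AffineGroup (FractionRing R)) (m : R⁰)
    [Fintype (R ⧸ Ideal.span {(m : R)})] :
    ∑ q : R ⧸ Ideal.span {(m : R)}, ρ.pair (g * affineBy m q.out) = ρ.pair g := by
  simp only [pair_mul]
  rw [← map_sum, pair]
  refine congrArg _ (Prod.ext ?_ ?_)
  · rw [Prod.fst_sum]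
    exact sum_act_affineBy_pHat m
  · have h := ρ.sum_eq m
    rw [finsum_eq_sum_of_fintype] at h
    rw [Prod.snd_sum]
    exact h

/-- Two representatives of a coset differ by some `m t`, and `(m, n + m t) = (m, n)(1, t)`; the
factor `(1, t)` fixes both `p` and `e`. -/
theorem pair_affineBy_out (g : AffineGroup (FractionRing R)) (m : R⁰) (n : R) :
    ρ.pair (g * affineBy m (Ideal.Quotient.mk (Ideal.span {(m : R)}) n).out) =
      ρ.pair (g * affineBy m n) := by
  have h := Ideal.Quotient.mk_out (Ideal.Quotient.mk (Ideal.span {(m : R)}) n)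
  rw [Ideal.Quotient.eq, Ideal.mem_span_singleton] at h
  obtain ⟨t, ht⟩ := h
  rw [← ρ.pair_mul_translationBy (g * affineBy m n) t, mul_assoc, ← affineBy_one, affineBy_mul,
    mul_one, ← ht, add_sub_cancel]

instance (m : R⁰) : Fintype (R ⧸ Ideal.span {(m : R)}) := Fintype.ofFinite _

/-- The step functions of level `(k, m)`, paired with their images. -/
def stepHom (k m : R⁰) : (R ⧸ Ideal.span {(m : R)} → ℂ) →⋆ₙₐ[ℂ] C₀(Adele R, ℂ) × M :=
  projHom (p := fun q : R ⧸ Ideal.span {(m : R)} => ρ.pair ((dilationBy k)⁻¹ * affineBy m q.out))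
    (fun _ => ρ.star_pair _) (fun _ => ρ.pair_mul_pair _) fun _ _ h =>
      mul_eq_zero_of_sum_eq (fun _ => ρ.star_pair _) (fun _ => ρ.pair_mul_pair _)
        (ρ.pair_mul_pair _) (ρ.sum_pair _ m) h

theorem pair_mem_range_stepHom (k m : R⁰) (n : R) :
    ρ.pair ((dilationBy k)⁻¹ * affineBy m n) ∈ NonUnitalStarAlgHom.range (ρ.stepHom k m) := by
  classical
  refine ⟨Pi.single (Ideal.Quotient.mk _ n) 1, ?_⟩
  rw [← ρ.pair_affineBy_out]
  refine (Finset.sum_eq_single (Ideal.Quotient.mk _ n) ?_ (by simp)).trans ?_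
  · intro q _ hq
    rw [Pi.single_eq_of_ne hq, zero_smul]
  · rw [Pi.single_eq_same, one_smul]

theorem range_stepHom_le {k m : R⁰} {S : NonUnitalStarSubalgebra ℂ (C₀(Adele R, ℂ) × M)}
    (h : ∀ n, ρ.pair ((dilationBy k)⁻¹ * affineBy m n) ∈ S) :
    NonUnitalStarAlgHom.range (ρ.stepHom k m) ≤ S := by
  rintro _ ⟨c, rfl⟩
  exact sum_mem fun q _ => SMulMemClass.smul_mem _ (h _)

/-- Expanding the fraction, `k⁻¹(m, n) = (lk)⁻¹(lm, ln)`. -/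
theorem range_stepHom_le_left (l k m : R⁰) : NonUnitalStarAlgHom.range (ρ.stepHom k m) ≤
    NonUnitalStarAlgHom.range (ρ.stepHom (l * k) (l * m)) :=
  ρ.range_stepHom_le fun n => by
    rw [← inv_mul_affineBy_mul_left l]
    exact ρ.pair_mem_range_stepHom _ _ _

/-- A coset modulo `m` splits into cosets modulo `m l`; the sum relation says so in both
coordinates. -/
theorem range_stepHom_le_right (l k m : R⁰) : NonUnitalStarAlgHom.range (ρ.stepHom k m) ≤
    NonUnitalStarAlgHom.range (ρ.stepHom k (m * l)) :=
  ρ.range_stepHom_le fun n => by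
    rw [← ρ.sum_pair _ l]
    refine sum_mem fun q _ => ?_
    rw [mul_assoc, affineBy_mul]
    exact ρ.pair_mem_range_stepHom _ _ _

theorem directed_range_stepHom : Directed (· ≤ ·) fun i : R⁰ × R⁰ =>
    NonUnitalStarAlgHom.range (ρ.stepHom i.1 i.2) := by
  rintro ⟨k, m⟩ ⟨k', m'⟩
  -- Over the common denominator `k k'` the moduli become `k' m` and `k m'`; their product refines
  -- both.
  refine ⟨(k * k', k' * m * (k * m')), ?_, ?_⟩
  · have h := (ρ.range_stepHom_le_left k' k m).trans (ρ.range_stepHom_le_right (k * m') _ _)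
    rwa [mul_comm k' k] at h
  · have h := (ρ.range_stepHom_le_left k k' m').trans (ρ.range_stepHom_le_right (k' * m) _ _)
    rwa [mul_comm (k * m')] at h

/-- The algebra of step functions, paired with their images. -/
def stepGraph : NonUnitalStarSubalgebra ℂ (C₀(Adele R, ℂ) × M) :=
  ⨆ i : R⁰ × R⁰, NonUnitalStarAlgHom.range (ρ.stepHom i.1 i.2)

theorem mem_stepGraph {x : C₀(Adele R, ℂ) × M} :
    x ∈ ρ.stepGraph ↔ ∃ k m c, ρ.stepHom k m c = x := by
  rw [← SetLike.mem_coe, stepGraph,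
    NonUnitalStarSubalgebra.coe_iSup_of_directed ρ.directed_range_stepHom, Set.mem_iUnion]
  exact ⟨fun ⟨i, c, h⟩ => ⟨i.1, i.2, c, h⟩, fun ⟨k, m, c, h⟩ => ⟨(k, m), c, h⟩⟩

theorem pair_mem_stepGraph (g : AffineGroup (FractionRing R)) : ρ.pair g ∈ ρ.stepGraph := by
  obtain ⟨d, c, r, rfl⟩ := exists_eq_inv_mul_affineBy g
  obtain ⟨x, hx⟩ := ρ.pair_mem_range_stepHom d c r
  exact ρ.mem_stepGraph.2 ⟨d, c, x, hx⟩

/-- The closure of the algebra of step functions, paired with their images. -/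
def graph : NonUnitalStarSubalgebra ℂ (C₀(Adele R, ℂ) × M) := ρ.stepGraph.topologicalClosure

theorem pair_fst_ne_zero (g : AffineGroup (FractionRing R)) : (ρ.pair g).1 ≠ 0 := fun h =>
  pHat_ne_zero ((map_eq_zero_iff (act g) (act g).injective).1 h)

/-- The translates of `p` are nonzero, so the first coordinate is injective on the algebra of step
functions of one level, hence isometric. -/
theorem norm_stepHom_fst (k m : R⁰) (c : R ⧸ Ideal.span {(m : R)} → ℂ) :
    ‖(ρ.stepHom k m c).1‖ = ‖c‖ := by
  refine NonUnitalStarAlgHom.norm_map ((NonUnitalStarAlgHom.fst ℂ _ _).comp (ρ.stepHom k m)) ?_ c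
  refine (injective_iff_map_eq_zero _).2 fun c hc => funext fun q => ?_
  have h := congrArg Prod.fst (projHom_mul (fun _ => ρ.star_pair _) (fun _ => ρ.pair_mul_pair _)
    (fun _ _ h => mul_eq_zero_of_sum_eq (fun _ => ρ.star_pair _) (fun _ => ρ.pair_mul_pair _)
      (ρ.pair_mul_pair _) (ρ.sum_pair (dilationBy k)⁻¹ m) h) c q)
  have hc' : (ρ.stepHom k m c).1 = 0 := hc
  rw [Prod.fst_mul, Prod.smul_fst] at h
  rw [stepHom] at hc'
  rw [hc', zero_mul] at h
  exact (smul_eq_zero.1 h.symm).resolve_right (ρ.pair_fst_ne_zero _)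

/-- At each level the second coordinate is contractive and the first isometric in the coefficients;
the inequality passes to the closure. It makes the second coordinate a function of the first. -/
theorem norm_snd_le_of_mem_graph {x : C₀(Adele R, ℂ) × M} (hx : x ∈ ρ.graph) :
    ‖x.2‖ ≤ ‖x.1‖ := by
  refine closure_minimal (t := {x : C₀(Adele R, ℂ) × M | ‖x.2‖ ≤ ‖x.1‖}) ?_
    (isClosed_le (by fun_prop) (by fun_prop)) hx
  intro x hx
  obtain ⟨k, m, c, rfl⟩ := ρ.mem_stepGraph.1 hx
  change ‖(ρ.stepHom k m c).2‖ ≤ ‖(ρ.stepHom k m c).1‖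
  rw [norm_stepHom_fst]
  exact NonUnitalStarAlgHom.norm_apply_le
    ((NonUnitalStarAlgHom.snd ℂ _ _).comp (ρ.stepHom k m)) c

/-- The projection of the graph to its domain. -/
def graphFst : ρ.graph →⋆ₙₐ[ℂ] C₀(Adele R, ℂ) :=
  (NonUnitalStarAlgHom.fst ℂ _ _).comp (NonUnitalStarSubalgebraClass.subtype ρ.graph)

theorem norm_graphFst (x : ρ.graph) : ‖ρ.graphFst x‖ = ‖x‖ :=
  (max_eq_left (ρ.norm_snd_le_of_mem_graph x.2)).symm

theorem isometry_graphFst : Isometry ρ.graphFst :=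
  AddMonoidHomClass.isometry_of_norm _ ρ.norm_graphFst

/-- The image is closed, being an isometric image of a complete space, and it contains the dense set
of step functions. -/
theorem surjective_graphFst : Function.Surjective ρ.graphFst := by
  have hc : IsClosed (ρ.graph : Set (C₀(Adele R, ℂ) × M)) :=
    NonUnitalStarSubalgebra.isClosed_topologicalClosure _
  have : CompleteSpace ρ.graph := hc.completeSpace_coe
  have hr : IsClosed (Set.range ρ.graphFst) := ρ.isometry_graphFst.isClosedEmbedding.isClosed_range
  intro f
  change f ∈ Set.range ρ.graphFst
  rw [← hr.closure_eq, Metric.mem_closure_iff]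
  intro ε hε
  obtain ⟨k, m, c, h⟩ := exists_step_approx f (half_pos hε)
  refine ⟨(ρ.stepHom k m c).1, ⟨⟨ρ.stepHom k m c, NonUnitalStarSubalgebra.le_topologicalClosure _
    (ρ.mem_stepGraph.2 ⟨k, m, c, rfl⟩)⟩, rfl⟩, ?_⟩
  have h1 : (ρ.stepHom k m c).1 = ∑ᶠ q : R ⧸ Ideal.span {(m : R)},
      c q • act ((dilationBy k)⁻¹ * affineBy m q.out) (Adele.pHat R) := by
    rw [finsum_eq_sum_of_fintype, stepHom, projHom_apply, Prod.fst_sum]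
    rfl
  rw [dist_eq_norm, h1]
  exact h.trans_lt (half_lt_self hε)

/-- The representation of `C₀(𝓡)` which maps the translates of `p_{R̂}` to those of `e`. -/
def rep : C₀(Adele R, ℂ) →⋆ₙₐ[ℂ] M :=
  ((NonUnitalStarAlgHom.snd ℂ _ _).comp (NonUnitalStarSubalgebraClass.subtype ρ.graph)).comp
    (StarAlgEquiv.ofBijective ρ.graphFst
      ⟨ρ.isometry_graphFst.injective, ρ.surjective_graphFst⟩).symm.toNonUnitalStarAlgHom

theorem rep_eq {x : C₀(Adele R, ℂ) × M} (hx : x ∈ ρ.graph) : ρ.rep x.1 = x.2 := by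
  have h : (StarAlgEquiv.ofBijective ρ.graphFst
      ⟨ρ.isometry_graphFst.injective, ρ.surjective_graphFst⟩).symm x.1 = ⟨x, hx⟩ :=
    (StarAlgEquiv.symm_apply_eq _).2 rfl
  exact congrArg (fun y : ρ.graph => y.1.2) h

theorem mem_graph (f : C₀(Adele R, ℂ)) : (f, ρ.rep f) ∈ ρ.graph := by
  obtain ⟨x, rfl⟩ := ρ.surjective_graphFst f
  change (x.1.1, ρ.rep x.1.1) ∈ ρ.graph
  rw [ρ.rep_eq x.2]
  exact x.2

theorem rep_pHat : ρ.rep (Adele.pHat R) = ρ.e := by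
  have h := ρ.rep_eq (NonUnitalStarSubalgebra.le_topologicalClosure _ (ρ.pair_mem_stepGraph 1))
  rwa [pair_one] at h

/-- The group permutes the generating pairs and acts continuously. Invariance of the graph is the
covariance of the representation it defines. -/
theorem pairAct_mem_graph (g : AffineGroup (FractionRing R)) {x : C₀(Adele R, ℂ) × M}
    (hx : x ∈ ρ.graph) : ρ.pairAct g x ∈ ρ.graph := by
  refine closure_minimal (t := ρ.pairAct g ⁻¹' (ρ.graph : Set (C₀(Adele R, ℂ) × M))) ?_
    ((NonUnitalStarSubalgebra.isClosed_topologicalClosure _).preimage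
      (continuous_hom (ρ.pairAct g))) hx
  intro x hx
  obtain ⟨k, m, c, rfl⟩ := ρ.mem_stepGraph.1 hx
  refine NonUnitalStarSubalgebra.le_topologicalClosure _ ?_
  rw [stepHom, projHom_apply, map_sum]
  refine sum_mem fun q _ => ?_
  rw [map_smul, ← pair_mul]
  exact SMulMemClass.smul_mem _ (ρ.pair_mem_stepGraph _)

theorem rep_act (g : AffineGroup (FractionRing R)) (f : C₀(Adele R, ℂ)) :
    ρ.rep (act g f) = ρ.U g * ρ.rep f * star (ρ.U g : M) :=
  ρ.rep_eq (ρ.pairAct_mem_graph g (ρ.mem_graph f))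

theorem covariant (g : AffineGroup (FractionRing R)) (f : C₀(Adele R, ℂ)) :
    (ρ.U g : M) * ρ.rep f = ρ.rep (act g f) * ρ.U g := by
  rw [rep_act, mul_assoc, Unitary.coe_star_mul_self, mul_one]

/-- The representation of the crossed product. -/
def integrated : AdelicCrossedProduct R →⋆ₙₐ[ℂ] M :=
  CrossedProduct.lift ρ.rep ρ.U ρ.covariant

theorem integrated_Vp (g : AffineGroup (FractionRing R)) : ρ.integrated (Vp g) = ρ.U g * ρ.e := by
  rw [integrated, Vp, CrossedProduct.lift_V, rep_pHat]

end AffineRep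

end Covariant

/-! ### The isomorphisms -/

section Main

variable {R : Type*} [CommRing R] [IsDomain R]

variable (R) in
/-- The unitary representation of the `ax + b`-group in the multiplier algebra of `𝔄(R)`. -/
def multiplierHom : AffineGroup (FractionRing R) →* unitary (DoubleCentralizer ℂ (StableAlg R)) :=
  affineLift (StableAlg.dilHom R) (StableAlg.transHom R) StableAlg.dilHom_mul_transHom

theorem multiplierHom_dilationBy (m : R⁰) :
    (multiplierHom R (dilationBy m) : DoubleCentralizer ℂ (StableAlg R)) = StableAlg.dil m := by
  rw [multiplierHom, affineLift_dilationBy]; rfl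

theorem multiplierHom_translationBy (n : R) :
    (multiplierHom R (translationBy n) : DoubleCentralizer ℂ (StableAlg R)) =
      StableAlg.trans n := by
  rw [multiplierHom, affineLift_translationBy]; rfl

theorem multiplierHom_affineBy_mul (m : R⁰) (n : R) :
    (multiplierHom R (affineBy m n) : DoubleCentralizer ℂ (StableAlg R)) *
      DoubleCentralizer.coeHom (StableAlg.of 1 1) =
        DoubleCentralizer.coeHom (StableAlg.of 1 (RingAlg.u n * RingAlg.s m)) := by
  rw [affineBy, map_mul, Submonoid.coe_mul, multiplierHom_dilationBy, multiplierHom_translationBy,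
    mul_assoc, multiplier_mul_coe, StableAlg.dil_fst, multiplier_mul_coe, StableAlg.trans_fst,
    RingAlg.mul_one', OneMemClass.coe_one, one_mul]

theorem multiplierHom_affineBy_conj (m : R⁰) (n : R) :
    (multiplierHom R (affineBy m n) : DoubleCentralizer ℂ (StableAlg R)) *
      DoubleCentralizer.coeHom (StableAlg.of 1 1) * star (multiplierHom R (affineBy m n) :
        DoubleCentralizer ℂ (StableAlg R)) = DoubleCentralizer.coeHom (StableAlg.of 1
          (RingAlg.u n * (RingAlg.s m * star (RingAlg.s m)) * star (RingAlg.u n))) := by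
  -- Since `e = e e⋆`, the conjugate `U e U⋆` is `(U e)(U e)⋆`, with `U e` known.
  have h : (DoubleCentralizer.coeHom (StableAlg.of 1 1) : DoubleCentralizer ℂ (StableAlg R)) =
      DoubleCentralizer.coeHom (StableAlg.of 1 1) *
        star (DoubleCentralizer.coeHom (StableAlg.of 1 1)) := by
    rw [← map_star, ← map_star, RingAlg.star_one', ← map_mul, ← map_mul, RingAlg.one_mul']
  rw [h, ← mul_assoc, mul_assoc, ← star_mul, multiplierHom_affineBy_mul, ← map_star, ← map_star,
    ← map_mul, ← map_mul, star_mul]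
  simp only [mul_assoc]

/-! ### The map from the stabilization to the crossed product -/

variable [∀ m : R⁰, Finite (R ⧸ Ideal.span {(m : R)})]

variable (R) in
theorem Vp_one : (Vp 1 : AdelicCrossedProduct R) = projHat R := CrossedProduct.V_one _

theorem star_Vp (g : AffineGroup (FractionRing R)) :
    star (Vp g) = CrossedProduct.V act g⁻¹ (act g (Adele.pHat R)) := by
  rw [Vp, CrossedProduct.star_V, star_pHat]

/-- For an integral matrix `h` one has `h R̂ ⊆ R̂`, so `p V_h p = V_h p` and the middle projection
disappears. -/
theorem Vp_mul_Vp_affineBy (g : AffineGroup (FractionRing R)) (m : R⁰) (n : R) :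
    Vp g * Vp (affineBy m n) = Vp (g * affineBy m n) := by
  rw [Vp, Vp, CrossedProduct.V_mul_V, Vp]
  congr 1
  have h := congrArg (act (affineBy m n)⁻¹) (pHat_mul_act_affineBy m n)
  rwa [map_mul, act_inv_act] at h

theorem star_Vp_mul_Vp (g : AffineGroup (FractionRing R)) : star (Vp g) * Vp g = projHat R := by
  rw [star_Vp, Vp, CrossedProduct.V_mul_V, inv_mul_cancel, act_inv_act, pHat_mul_pHat,
    CrossedProduct.V_one]
  rfl

/-- Used from right to left: it writes elements `V_g α_h(p)` as products of elements `V_g p` and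
their adjoints. -/
theorem Vp_mul_star_Vp (g h : AffineGroup (FractionRing R)) :
    Vp g * star (Vp h) = CrossedProduct.V act (g * h⁻¹) (act h (Adele.pHat R)) := by
  rw [star_Vp, Vp, CrossedProduct.V_mul_V, inv_inv, ← map_mul, pHat_mul_pHat]

theorem Vp_mul_star_Vp_self (g : AffineGroup (FractionRing R)) :
    Vp g * star (Vp g) = CrossedProduct.inclusion act (act g (Adele.pHat R)) := by
  rw [Vp_mul_star_Vp, mul_inv_cancel, CrossedProduct.V_one]

theorem projHat_mul_projHat : projHat R * projHat R = projHat R := by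
  rw [projHat, ← map_mul, pHat_mul_pHat]

theorem Vp_mul_projHat (g : AffineGroup (FractionRing R)) : Vp g * projHat R = Vp g := by
  have h := Vp_mul_Vp_affineBy g 1 (0 : R)
  rwa [affineBy_zero, dilationBy_one, Vp_one, mul_one] at h

theorem projHat_mul_Vp (m : R⁰) (n : R) :
    projHat R * Vp (affineBy m n) = Vp (affineBy m n) := by
  rw [← Vp_one, Vp_mul_Vp_affineBy, one_mul]

theorem star_Vp_translationBy (n : R) :
    star (Vp (translationBy n)) = Vp (translationBy (-n)) := by
  rw [star_Vp, act_translationBy_pHat, translationBy_neg, Vp]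

variable (R) in
/-- The elements `V_g p_{R̂}` for integral dilations and translations satisfy the relations of
`𝔄[R]`. -/
def adelicRep : RingRep R (AdelicCrossedProduct R) where
  e := projHat R
  s m := Vp (dilationBy m)
  u n := Vp (translationBy n)
  star_e := isSelfAdjoint_projHat R
  e_mul_e := projHat_mul_projHat
  e_mul_s m := by rw [← affineBy_zero, projHat_mul_Vp]
  s_mul_e m := Vp_mul_projHat _
  e_mul_u n := by rw [← affineBy_one, projHat_mul_Vp]
  u_mul_e n := Vp_mul_projHat _
  star_s_mul_s m := star_Vp_mul_Vp _
  star_u_mul_u n := star_Vp_mul_Vp _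
  u_mul_star_u n := by rw [Vp_mul_star_Vp_self, act_translationBy_pHat]; rfl
  s_mul_s k m := by rw [← affineBy_zero m, Vp_mul_Vp_affineBy, affineBy_zero, dilationBy_mul]
  u_mul_u l n := by rw [← affineBy_one n, Vp_mul_Vp_affineBy, affineBy_one, translationBy_add]
  s_mul_u m n := by
    rw [← affineBy_one n, Vp_mul_Vp_affineBy, affineBy_one, dilationBy_mul_translationBy,
      ← affineBy_zero m, Vp_mul_Vp_affineBy]
  sum_eq m := by
    rw [finsum_eq_sum_of_fintype, projHat, ← sum_act_affineBy_pHat m, map_sum]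
    refine Finset.sum_congr rfl fun q _ => ?_
    rw [← star_Vp_translationBy, ← mul_assoc, mul_assoc, ← star_mul, ← affineBy_zero,
      Vp_mul_Vp_affineBy, affineBy_zero]
    exact Vp_mul_star_Vp_self _

variable (R) in
/-- The map from `𝔄[R]` to the crossed product. -/
def toCrossed : RingAlg R →⋆ₙₐ[ℂ] AdelicCrossedProduct R := (adelicRep R).lift

theorem toCrossed_s (m : R⁰) : toCrossed R (RingAlg.s m) = Vp (dilationBy m) :=
  (adelicRep R).lift_s m

theorem toCrossed_u (n : R) : toCrossed R (RingAlg.u n) = Vp (translationBy n) :=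
  (adelicRep R).lift_u n

theorem toCrossed_one : toCrossed R 1 = projHat R := (adelicRep R).lift_one

theorem projHat_mul_toCrossed (x : RingAlg R) : projHat R * toCrossed R x = toCrossed R x := by
  rw [← toCrossed_one, ← map_mul, RingAlg.one_mul']

theorem toCrossed_mul_projHat (x : RingAlg R) : toCrossed R x * projHat R = toCrossed R x := by
  rw [← toCrossed_one, ← map_mul, RingAlg.mul_one']

/-- The map `x ↦ V_k⋆ β(x) V_k`. -/
def toCrossedAt (k : R⁰) : RingAlg R →⋆ₙₐ[ℂ] AdelicCrossedProduct R where
  -- The unitary `V_k⋆` is replaced by `V_k⋆ p`, an element of the crossed product; nothing changes,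
  -- as `β(x)` lies in the corner of `p`.
  toFun x := Vp (dilationBy k)⁻¹ * toCrossed R x * star (Vp (dilationBy k)⁻¹)
  map_smul' c x := by simp only [map_smul, mul_smul_comm, smul_mul_assoc]; rfl
  map_zero' := by simp
  map_add' x y := by simp [mul_add, add_mul]
  map_mul' x y := by
    simp only [mul_assoc]
    rw [← mul_assoc (star (Vp (dilationBy k)⁻¹)) (Vp (dilationBy k)⁻¹), star_Vp_mul_Vp,
      ← mul_assoc (projHat R), projHat_mul_toCrossed, map_mul, mul_assoc]
  map_star' x := by simp [mul_assoc, map_star]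

theorem toCrossedAt_apply (k : R⁰) (x : RingAlg R) :
    toCrossedAt k x = Vp (dilationBy k)⁻¹ * toCrossed R x * star (Vp (dilationBy k)⁻¹) := rfl

/-- The image of `s_l` is absorbed by the change of level: `V_{lk}⋆ V_l p = V_k⋆ p`. -/
theorem toCrossedAt_conj (k l : R⁰) (x : RingAlg R) :
    toCrossedAt (l * k) (RingAlg.conj l x) = toCrossedAt k x := by
  have h : Vp (dilationBy (l * k))⁻¹ * Vp (dilationBy l) = Vp (dilationBy k)⁻¹ := by
    rw [← affineBy_zero l, Vp_mul_Vp_affineBy, affineBy_zero, dilationBy_mul, mul_inv_rev,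
      inv_mul_cancel_right]
  rw [toCrossedAt_apply, toCrossedAt_apply, ← h, star_mul]
  change _ * toCrossed R (RingAlg.s l * x * star (RingAlg.s l)) * _ = _
  rw [map_mul, map_mul, map_star, toCrossed_s]
  simp only [mul_assoc]

variable (R) in
/-- The map from `𝔄(R)` to the crossed product. -/
def stableToCrossed : StableAlg R →⋆ₙₐ[ℂ] AdelicCrossedProduct R :=
  StableAlg.lift toCrossedAt toCrossedAt_conj

theorem stableToCrossed_of (k : R⁰) (x : RingAlg R) :
    stableToCrossed R (StableAlg.of k x) = toCrossedAt k x :=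
  StableAlg.lift_of _ _ k x

theorem stableToCrossed_of_one (x : RingAlg R) :
    stableToCrossed R (StableAlg.of 1 x) = toCrossed R x := by
  rw [stableToCrossed_of, toCrossedAt_apply, dilationBy_one, inv_one, Vp_one,
    (isSelfAdjoint_projHat R).star_eq, projHat_mul_toCrossed, toCrossed_mul_projHat]

/-! ### The left inverse in the multiplier algebra -/

variable (R) in
/-- The covariant representation in the multiplier algebra of `𝔄(R)`. -/
def multiplierRep : AffineRep R (DoubleCentralizer ℂ (StableAlg R)) where
  U := multiplierHom R
  e := DoubleCentralizer.coeHom (StableAlg.of 1 1)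
  star_e := by rw [← map_star, ← map_star, RingAlg.star_one']
  e_mul_e := by rw [← map_mul, ← map_mul, RingAlg.one_mul']
  translation n := by
    rw [← affineBy_one, multiplierHom_affineBy_conj, RingAlg.s_one, RingAlg.one_mul',
      RingAlg.star_one', RingAlg.mul_one', RingAlg.u_mul_star_u]
  sum_eq m := by
    rw [finsum_eq_sum_of_fintype]
    simp only [multiplierHom_affineBy_conj]
    rw [← map_sum, ← map_sum, RingAlg.sum_eq_one]

theorem integrated_toCrossed (x : RingAlg R) : (multiplierRep R).integrated (toCrossed R x) =
    DoubleCentralizer.coeHom (StableAlg.of 1 x) := by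
  have h : (multiplierRep R).integrated.comp (toCrossed R) =
      (DoubleCentralizer.coeHom (𝕜 := ℂ)).comp (StableAlg.of 1) := by
    refine RingAlg.hom_ext (fun m => ?_) fun n => ?_
    · change (multiplierRep R).integrated (toCrossed R _) = _
      rw [toCrossed_s, AffineRep.integrated_Vp, ← affineBy_zero]
      refine (multiplierHom_affineBy_mul m 0).trans ?_
      rw [RingAlg.u_zero, RingAlg.one_mul']
      rfl
    · change (multiplierRep R).integrated (toCrossed R _) = _
      rw [toCrossed_u, AffineRep.integrated_Vp, ← affineBy_one]
      refine (multiplierHom_affineBy_mul 1 n).trans ?_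
      rw [RingAlg.s_one, RingAlg.mul_one']
      rfl
  exact DFunLike.congr_fun h x

/-- It suffices to compare at each level `k`. Level `1` is a check on generators; the other levels
follow because conjugation by the unitary of `k` corresponds to passing from `ω_1` to `ω_k`. -/
theorem integrated_stableToCrossed (x : StableAlg R) :
    (multiplierRep R).integrated (stableToCrossed R x) = DoubleCentralizer.coeHom x := by
  refine StableAlg.ind x (isClosed_eq ((continuous_hom _).comp (continuous_hom _))
    (continuous_hom _)) fun k y => ?_
  have h : ((multiplierHom R (dilationBy k)⁻¹ : unitary _) : DoubleCentralizer ℂ (StableAlg R)) =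
      star (StableAlg.dil k) := by
    rw [map_inv, ← multiplierHom_dilationBy]; rfl
  -- The projections that accompany the unitaries are units for the image of `ω_1`.
  have he : ∀ z : RingAlg R, (DoubleCentralizer.coeHom (StableAlg.of 1 1) *
      DoubleCentralizer.coeHom (StableAlg.of 1 z) * star (DoubleCentralizer.coeHom
        (StableAlg.of 1 1)) : DoubleCentralizer ℂ (StableAlg R)) =
          DoubleCentralizer.coeHom (StableAlg.of 1 z) := fun z => by
    simp only [← map_star, ← map_mul, RingAlg.star_one', RingAlg.one_mul', RingAlg.mul_one']
  rw [stableToCrossed_of, toCrossedAt_apply, map_mul, map_mul, map_star, integrated_toCrossed,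
    AffineRep.integrated_Vp]
  change (multiplierHom R (dilationBy k)⁻¹ : DoubleCentralizer ℂ (StableAlg R)) *
    DoubleCentralizer.coeHom (StableAlg.of 1 1) * DoubleCentralizer.coeHom (StableAlg.of 1 y) *
    star ((multiplierHom R (dilationBy k)⁻¹ : DoubleCentralizer ℂ (StableAlg R)) *
      DoubleCentralizer.coeHom (StableAlg.of 1 1)) = _
  rw [← StableAlg.star_dil_mul_of_mul_dil k y, star_mul, h, star_star]
  conv_rhs => rw [← he y]
  simp only [mul_assoc]

/-! ### Bijectivity -/

variable (R) in
theorem injective_stableToCrossed : Function.Injective (stableToCrossed R) := fun x y h =>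
  coeHom_injective (by rw [← integrated_stableToCrossed, h, integrated_stableToCrossed])

variable (R) in
theorem isClosed_range_stableToCrossed : IsClosed (Set.range (stableToCrossed R)) :=
  (NonUnitalStarAlgHom.isometry _
    (injective_stableToCrossed R)).isClosedEmbedding.isClosed_range

theorem Vp_mul_star_Vp_mem_range (k c c' : R⁰) (r r' : R) :
    Vp ((dilationBy k)⁻¹ * affineBy c r) * star (Vp ((dilationBy k)⁻¹ * affineBy c' r')) ∈
      Set.range (stableToCrossed R) := by
  have h : ∀ (c : R⁰) (r : R), toCrossed R (RingAlg.u r * RingAlg.s c) = Vp (affineBy c r) :=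
    fun c r => by
      rw [map_mul, toCrossed_u, toCrossed_s, ← affineBy_zero, Vp_mul_Vp_affineBy, affineBy_zero]
      rfl
  refine ⟨StableAlg.of k (RingAlg.u r * RingAlg.s c * star (RingAlg.u r' * RingAlg.s c')), ?_⟩
  rw [stableToCrossed_of, toCrossedAt_apply, map_mul, map_star, h, h, ← Vp_mul_Vp_affineBy,
    ← Vp_mul_Vp_affineBy, star_mul]
  simp only [mul_assoc]

theorem V_act_pHat_mem_range (g h : AffineGroup (FractionRing R)) :
    CrossedProduct.V act g (act h (Adele.pHat R)) ∈ Set.range (stableToCrossed R) := by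
  have h1 := Vp_mul_star_Vp (g * h) h
  rw [mul_inv_cancel_right] at h1
  rw [← h1]
  obtain ⟨d, c, r, hd⟩ := exists_eq_inv_mul_affineBy (g * h)
  obtain ⟨d', c', r', hd'⟩ := exists_eq_inv_mul_affineBy h
  -- Both fractions are expanded to the common denominator `d d'`, so that a single level of the
  -- limit suffices.
  rw [hd, hd', ← inv_mul_affineBy_mul_left d', ← inv_mul_affineBy_mul_left d d', mul_comm d' d]
  exact Vp_mul_star_Vp_mem_range _ _ _ _ _

variable (R) in
theorem surjective_stableToCrossed : Function.Surjective (stableToCrossed R) := by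
  intro x
  change x ∈ Set.range (stableToCrossed R)
  have hadd : ∀ x y, x ∈ Set.range (stableToCrossed R) → y ∈ Set.range (stableToCrossed R) →
      x + y ∈ Set.range (stableToCrossed R) := by
    rintro _ _ ⟨a, rfl⟩ ⟨b, rfl⟩
    exact ⟨a + b, map_add _ a b⟩
  refine CrossedProduct.ind x (isClosed_range_stableToCrossed R) (fun g f => ?_) hadd
  let V : C₀(Adele R, ℂ) →ₗ[ℂ] AdelicCrossedProduct R :=
    { toFun := CrossedProduct.V act g
      map_add' := CrossedProduct.V_add g
      map_smul' := CrossedProduct.V_smul g }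
  -- `f ↦ V_g f` is contractive, because `(V_g f)⋆ V_g f = f⋆ f`; hence approximation of `f` by step
  -- functions is enough.
  have hV : Continuous V := by
    refine AddMonoidHomClass.continuous_of_bound V 1 fun f => ?_
    rw [one_mul]
    have h : star (CrossedProduct.V act g f) * CrossedProduct.V act g f =
        CrossedProduct.inclusion act (star f * f) := by
      rw [CrossedProduct.star_V, CrossedProduct.V_mul_V, inv_mul_cancel, act_inv_act,
        CrossedProduct.V_one]
    have h2 := NonUnitalStarAlgHom.norm_apply_le (CrossedProduct.inclusion act) (star f * f)
    have h3 : ‖star f * f‖ = ‖f‖ * ‖f‖ := CStarRing.norm_star_mul_self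
    rw [← h, CStarRing.norm_star_mul_self, h3] at h2
    exact abs_le_of_sq_le_sq' (by rw [sq, sq]; exact h2) (norm_nonneg _) |>.2
  have hcl : IsClosed (V ⁻¹' Set.range (stableToCrossed R)) :=
    (isClosed_range_stableToCrossed R).preimage hV
  change f ∈ V ⁻¹' Set.range (stableToCrossed R)
  rw [← hcl.closure_eq, Metric.mem_closure_iff]
  intro ε hε
  obtain ⟨k, m, c, h⟩ := exists_step_approx f (half_pos hε)
  refine ⟨_, ?_, (dist_eq_norm f _).trans_le h |>.trans_lt (half_lt_self hε)⟩
  rw [finsum_eq_sum_of_fintype, Set.mem_preimage, map_sum]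
  refine Finset.sum_induction _ (· ∈ Set.range (stableToCrossed R)) hadd ⟨0, map_zero _⟩
    fun q _ => ?_
  rw [map_smul]
  obtain ⟨a, ha⟩ := V_act_pHat_mem_range g ((dilationBy k)⁻¹ * affineBy m q.out)
  exact ⟨c q • a, by rw [map_smul, ha]; rfl⟩

variable (R) in
/-- The map from `𝔄[R]` to the corner of the crossed product. -/
def toCorner : RingAlg R →⋆ₙₐ[ℂ] AdelicCorner R :=
  NonUnitalStarAlgHom.codRestrict (toCrossed R) (AdelicCorner R) fun x =>
    mem_corner _ (projHat_mul_toCrossed x) (toCrossed_mul_projHat x)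

variable (R) in
-- The map is `Φ ∘ ω_1` followed by nothing but a restriction of the codomain. Surjectivity
-- transports the corner back along `Φ` to the corner of `ω_1(1)`, which is the range of `ω_1`.
theorem bijective_toCorner : Function.Bijective (toCorner R) := by
  constructor
  · intro x y h
    have h1 : toCrossed R x = toCrossed R y := congrArg Subtype.val h
    rw [← stableToCrossed_of_one, ← stableToCrossed_of_one] at h1
    exact (AddMonoidHomClass.isometry_of_norm _ (StableAlg.norm_of (1 : R⁰))).injective
      (injective_stableToCrossed R h1)
  · rintro ⟨_, d, rfl⟩
    obtain ⟨a, rfl⟩ := surjective_stableToCrossed R d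
    obtain ⟨x, hx⟩ := StableAlg.of_one_mul_mul_of_one_mem_range a
    refine ⟨x, Subtype.ext ?_⟩
    change toCrossed R x = projHat R * stableToCrossed R a * projHat R
    rw [← toCrossed_one, ← stableToCrossed_of_one, ← stableToCrossed_of_one, hx, map_mul, map_mul]

end Main

end

end RingCStar

theorem mainTheorem4 (R : Type*) [CommRing R] [IsDomain R] (hR : ¬ IsField R)
    [∀ m : R⁰, Finite (R ⧸ Ideal.span {(m : R)})] :
    ∃ (Φ : StableAlg R ≃⋆ₐ[ℂ] AdelicCrossedProduct R) (β : RingAlg R ≃⋆ₐ[ℂ] AdelicCorner R),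
      (∀ n : R, (β (RingAlg.u n) : AdelicCrossedProduct R) = Vp (translationBy n)) ∧
      (∀ m : R⁰, (β (RingAlg.s m) : AdelicCrossedProduct R) = Vp (dilationBy m)) ∧
      (∀ (k : R⁰) (x : RingAlg R), Φ (StableAlg.of k x) =
        Vp (dilationBy k)⁻¹ * (β x : AdelicCrossedProduct R) * star (Vp (dilationBy k)⁻¹)) :=
  ⟨StarAlgEquiv.ofBijective (stableToCrossed R)
      ⟨injective_stableToCrossed R, surjective_stableToCrossed R⟩,
    StarAlgEquiv.ofBijective (toCorner R) (bijective_toCorner R),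
    toCrossed_u, toCrossed_s, stableToCrossed_of⟩
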